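/- Let $\mathrm{CGA}$ be the real Clifford algebra of signature $(4,1)$ with orthonormal basis $e_1,e_2,e_3,e_+,e_-$ ($e_1^2=e_2^2=e_3^2=e_+^2=1$, $e_-^2=-1$, $e_{ij}=e_ie_j$), let $\mathrm{CGA}_+$ be its even subalgebra and $a\mapsto\tilde a$ the reversion, applied to polynomials in a central indeterminate $t$ coefficientwise. A polynomial $C\in\mathrm{CGA}_+[t]$ is a *motion polynomial* if $C\tilde C=\tilde C C\in\mathbb R[t]\setminus\{0\}$. A factorization $C=(t-h_1)(t-h_2)$ with $h_1,h_2\in\mathrm{CGA}_+$ is *irregular* if for some $\ell\in\{1,2\}$ the remainder $r_1t+r_0$ of $(t-h_1)\cdots(t-h_\ell)$ or of $(t-h_\ell)\cdots(t-h_2)$ upon division by $(t-h_\ell)(t-\tilde h_\ell)$ has a non-invertible coefficient $r_1$. **Theorem (Villarceau Motion).** Let $C\in\mathrm{CGA}_+[t]$ be a motion polynomial of degree two that has an irregular factorization $C=(t-h_1)(t-h_2)$ with $h_1,h_2\in\mathrm{CGA}_+$ and $h_1h_2=h_2h_1$. Then at least one of the following holds. 1. $C$ is a trivial motion, i.e.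 a (possibly non-linear) reparametrization of a simple motion: there are a map $f\colon\mathbb R\to\mathbb R$ and an $h\in\mathrm{CGA}_+$ with $(s-h)\widetilde{(s-h)}\in\mathbb R$ for all $s\in\mathbb R$ such that, for all but finitely many $t\in\mathbb R$, $C(t)$ and $f(t)-h$ agree up to a nonzero real factor. 2. $C$ is conformally equivalent to the Villarceau motion $(t-e_{12})(t-e_{3+})$: there are $a\in\mathrm{CGA}_+$ with $a\tilde a=\tilde a a\in\mathbb R\setminus\{0\}$ and real numbers $\alpha\ne0$, $\beta$, $c\neq 0$ with $$a\,C(\alpha t+\beta)\,\tilde a=c\,(t-e_{12})(t-e_{3+}).$$ -/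

import Mathlib

open Polynomial

noncomputable section

namespace CGA

/-- The quadratic form `x₁² + x₂² + x₃² + x₊² - x₋²` on `ℝ⁵`; the coordinates `0, 1, 2, 3, 4`
belong to the basis vectors `e₁, e₂, e₃, e₊, e₋`. -/
def form : QuadraticForm ℝ (Fin 5 → ℝ) :=
  QuadraticMap.weightedSumSquares ℝ (![1, 1, 1, 1, -1] : Fin 5 → ℝ)

/-- Conformal geometric algebra: the real Clifford algebra of signature `(4,1)`. -/
abbrev Alg : Type := CliffordAlgebra form

/-- The even subalgebra of conformal geometric algebra. -/
abbrev Even : Type := CliffordAlgebra.even form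

/-- The orthonormal basis vectors: `e 0 = e₁`, `e 1 = e₂`, `e 2 = e₃`, `e 3 = e₊`, `e 4 = e₋`. -/
def e (i : Fin 5) : Alg := CliffordAlgebra.ι form (Pi.single i 1)

/-- The element `e i * e j` of the even subalgebra. -/
def bi (i j : Fin 5) : Even :=
  ⟨e i * e j, CliffordAlgebra.ι_mul_ι_mem_evenOdd_zero form _ _⟩

/-- The reversion of the Clifford algebra, restricted to the even subalgebra. -/
def rev (a : Even) : Even :=
  ⟨CliffordAlgebra.reverse (a : Alg),
    (CliffordAlgebra.reverse_mem_evenOdd_iff (Q := form) (n := 0)).2 a.2⟩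

/-- `a` is a real scalar. -/
def IsReal (a : Even) : Prop := ∃ r : ℝ, a = algebraMap ℝ Even r

/-- `a` represents a conformal displacement: `a * rev a = rev a * a` is a nonzero real number. -/
def IsDisplacement (a : Even) : Prop :=
  ∃ r : ℝ, r ≠ 0 ∧ a * rev a = algebraMap ℝ Even r ∧ rev a * a = algebraMap ℝ Even r

/-- Reversion of a polynomial: all coefficients are reversed. -/
def polyRev (P : Even[X]) : Even[X] := P.sum fun n c => monomial n (rev c)

/-- The linear polynomial `t - h`. -/
def lin (h : Even) : Even[X] := X - C h

/-- The value at a real parameter. -/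
def evalReal (P : Even[X]) (t : ℝ) : Even := P.eval (algebraMap ℝ Even t)

/-- Motion polynomials: left and right quadrance agree and are a nonzero real polynomial. -/
def IsMotionPolynomial (P : Even[X]) : Prop :=
  ∃ N : ℝ[X], N ≠ 0 ∧ P * polyRev P = N.map (algebraMap ℝ Even) ∧
    polyRev P * P = N.map (algebraMap ℝ Even)

/-- `t - h` is a simple motion: its quadrance is real for every real `t`. -/
def IsSimpleMotion (h : Even) : Prop :=
  ∀ t : ℝ, IsReal ((algebraMap ℝ Even t - h) * rev (algebraMap ℝ Even t - h))

/-- The product `(t - h₁) ⋯ (t - hₙ)`. -/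
def linProd (l : List Even) : Even[X] := (l.map lin).prod

/-- The factorization `P = (t - h₁) ⋯ (t - hₙ)` (with `l = [h₁, …, hₙ]`) is irregular: for some
index `i`, with `M = (t - hᵢ)(t - rev hᵢ)`, the remainder `R = r₁ t + r₀` of
`(t - h₁) ⋯ (t - hᵢ)` modulo `M` (`M` on the right), or that of `(t - hᵢ) ⋯ (t - hₙ)` modulo `M`
(`M` on the left), has a non-invertible coefficient `r₁`.  Quotient and remainder exist and are
unique because `M` is monic of degree two. -/
def IsIrregularFactorization (P : Even[X]) (l : List Even) : Prop :=
  P = linProd l ∧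
    ∃ (i : ℕ) (hi : i < l.length) (Q R : Even[X]),
      R.degree < 2 ∧ ¬ IsUnit (R.coeff 1) ∧
        (linProd (l.take (i + 1)) = Q * (lin l[i] * lin (rev l[i])) + R ∨
          linProd (l.drop i) = (lin l[i] * lin (rev l[i])) * Q + R)

/-- Trivial motions, that is, possibly non-linear reparametrizations `f(t) - h` of a simple motion
`t - h`.  Displacements are points of projective space, so `P(t)` and `f(t) - h` are compared up to
a nonzero real factor; finitely many parameters (zeros of `P`, poles of `f`) are exempt. -/
def IsTrivialMotion (P : Even[X]) : Prop :=
  ∃ (f : ℝ → ℝ) (h : Even), IsSimpleMotion h ∧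
    {t : ℝ | ¬ ∃ c : ℝ, c ≠ 0 ∧ evalReal P t = c • (algebraMap ℝ Even (f t) - h)}.Finite

/-- Conformal equivalence of motions: conjugation by a fixed conformal displacement `a` carries
one into the other, up to a constant nonzero real factor and an affine change
`t ↦ α t + β` of the real motion parameter. -/
def ConformallyEquivalent (P P' : Even[X]) : Prop :=
  ∃ (a : Even) (α β c : ℝ), IsDisplacement a ∧ α ≠ 0 ∧ c ≠ 0 ∧
    C a * P.comp (C (algebraMap ℝ Even α) * X + C (algebraMap ℝ Even β)) * C (rev a) = c • P'

/-- The conformal Villarceau motion `(t - e₁₂)(t - e₃₊)`. -/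
def villarceau : Even[X] := lin (bi 0 1) * lin (bi 2 3)

end CGA

end

/-! The even subalgebra is the algebra of 2×2 quaternion matrices, with reversion the adjoint for a
hermitian form of signature (1,1) (`toMat`, `toMat_rev`). Grades 0 and 4 become the self-adjoint
matrices, grade 2 the skew-adjoint ones. For two factors, irregularity says exactly that `h₁ - rev
h₂` is not a unit.

Since the quadrance is real, a real shift of `t` makes `B = -(h₁ + h₂)` skew-adjoint. Write `B² = β
+ 2W` with `W` of grade 4 and `W² = ω`. Reality of the quadrance then forces the motion into the
form `t² + tB + (q + C + W)` with `C` skew-adjoint, `BC` real and `C² = γ + 2qW`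
(`exists_normal_form`); irregularity becomes non-invertibility of `h₁ + rev h₁ - B`.

If `W = 0`, the aim is that `B` and `C` are proportional, for then the motion takes values in the
span of 1 and one element with real square, and it is trivial. Only `B² = 0`, `B ≠ 0` needs an
argument: there the commuting root and irregularity give the proportionality
(`exists_smul_of_null`).

If `W ≠ 0`, everything relevant lies in the commutative algebra generated by `B`, `W`, `h₁`.
Irregularity is then the vanishing of a norm from `ℝ[W]`. Combined with the inequality `4ω ≤ β²`,
valid for every skew-adjoint `B`, and the sign of `β`, it yields `C = 0`, `q = 0` and `β² = 4ω`
(`eq_zero_of_commRing`). The motion is `t² + tB + W` with `B` extremal for the inequality.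
Extremality gives `B` a non-isotropic kernel, so a displacement carries `B` to `diag(0, x)` and then
to a multiple of the image of `e₁₂ + e₃₊`; `W` follows along, being determined by `B²`. -/

noncomputable section

namespace CGA

open Quaternion

/-! ### Quaternion matrices with an indefinite adjoint -/

/-- The matrix model of the even subalgebra. -/
abbrev Mat : Type := Matrix (Fin 2) (Fin 2) ℍ[ℝ]

/-- The reversion in the matrix model: the adjoint with respect to a hermitian form of
signature `(1,1)`. -/
def rv (x : Mat) : Mat :=
  !![star (x 0 0), -star (x 1 0); -star (x 0 1), star (x 1 1)]

theorem Mat.ext {x y : Mat} (h₀ : x 0 0 = y 0 0) (h₁ : x 0 1 = y 0 1) (h₂ : x 1 0 = y 1 0)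
    (h₃ : x 1 1 = y 1 1) : x = y := by
  ext1 i j; fin_cases i <;> fin_cases j <;> assumption

theorem mat_algebraMap (r : ℝ) : algebraMap ℝ Mat r = !![(r : ℍ[ℝ]), 0; 0, (r : ℍ[ℝ])] := by
  apply Mat.ext <;> simp [Matrix.algebraMap_matrix_apply]

theorem rv_mul (x y : Mat) : rv (x * y) = rv y * rv x := by
  apply Mat.ext <;> simp [rv, Matrix.mul_apply, Fin.sum_univ_two] <;> abel

theorem rv_add (x y : Mat) : rv (x + y) = rv x + rv y := by
  apply Mat.ext <;> simp [rv] <;> abel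

theorem rv_smul (r : ℝ) (x : Mat) : rv (r • x) = r • rv x := by
  apply Mat.ext <;> simp [rv]

theorem rv_neg (x : Mat) : rv (-x) = -rv x := by
  apply Mat.ext <;> simp [rv]

theorem rv_sub (x y : Mat) : rv (x - y) = rv x - rv y := by
  rw [sub_eq_add_neg, rv_add, rv_neg, sub_eq_add_neg]

theorem rv_rv (x : Mat) : rv (rv x) = x := by
  apply Mat.ext <;> simp [rv]

theorem rv_algebraMap (r : ℝ) : rv (algebraMap ℝ Mat r) = algebraMap ℝ Mat r := by
  rw [mat_algebraMap]; apply Mat.ext <;> simp [rv]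

/-- Self-adjoint matrices of trace zero: the elements of grade four. -/
def sym (f : ℝ) (y : ℍ[ℝ]) : Mat := !![(f : ℍ[ℝ]), y; -star y, -(f : ℍ[ℝ])]

theorem sym_sq (f : ℝ) (y : ℍ[ℝ]) :
    sym f y * sym f y = algebraMap ℝ Mat (f ^ 2 - normSq y) := by
  rw [mat_algebraMap]
  apply Mat.ext <;> simp [sym, Matrix.mul_apply, Fin.sum_univ_two, self_mul_star, star_mul_self,
    Quaternion.coe_commutes, sq, sub_eq_add_neg, add_comm]

/-- The diagonal entries are real and the off-diagonal ones determine each other; half the sum and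
half the difference of the diagonal separate grade 0 from grade 4. -/
theorem exists_eq_of_rv_eq {x : Mat} (h : rv x = x) :
    ∃ (s f : ℝ) (y : ℍ[ℝ]), x = algebraMap ℝ Mat s + sym f y := by
  have h0 := congrFun (congrFun h 0) 0
  have h1 := congrFun (congrFun h 1) 0
  have h3 := congrFun (congrFun h 1) 1
  simp only [rv, Matrix.of_apply, Matrix.cons_val', Matrix.cons_val_zero, Matrix.cons_val_one,
    Matrix.cons_val_fin_one] at h0 h1 h3
  rw [star_eq_self] at h0 h3
  refine ⟨((x 0 0).re + (x 1 1).re) / 2, ((x 0 0).re - (x 1 1).re) / 2, x 0 1, ?_⟩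
  rw [mat_algebraMap]
  apply Mat.ext
  · simp only [Matrix.add_apply, sym, Matrix.of_apply, Matrix.cons_val', Matrix.cons_val_zero,
      Matrix.cons_val_fin_one]
    rw [← Quaternion.coe_add]
    refine h0.trans (congrArg _ ?_)
    ring
  · simp [sym]
  · simp [sym, h1]
  · simp only [Matrix.add_apply, sym, Matrix.of_apply, Matrix.cons_val', Matrix.cons_val_one,
      Matrix.cons_val_fin_one]
    rw [← Quaternion.coe_neg, ← Quaternion.coe_add]
    refine h3.trans (congrArg _ ?_)
    ring

theorem exists_eq_of_rv_eq_neg {x : Mat} (h : rv x = -x) :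
    ∃ p m q : ℍ[ℝ], star p = -p ∧ star q = -q ∧ x = !![p, m; star m, q] := by
  have h0 := congrFun (congrFun h 0) 0
  have h1 := congrFun (congrFun h 1) 0
  have h3 := congrFun (congrFun h 1) 1
  simp only [rv, Matrix.of_apply, Matrix.cons_val', Matrix.cons_val_zero, Matrix.cons_val_one,
    Matrix.cons_val_fin_one, Matrix.neg_apply] at h0 h1 h3
  refine ⟨x 0 0, x 0 1, x 1 1, h0, h3, ?_⟩
  apply Mat.ext <;> simp
  simpa using h1.symm

theorem isUnit_of_mul_eq {A : Type*} [Ring A] [Algebra ℝ A] {x y : A} {r : ℝ} (hr : r ≠ 0)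
    (h₁ : x * y = algebraMap ℝ A r) (h₂ : y * x = algebraMap ℝ A r) : IsUnit x := by
  refine ⟨⟨x, r⁻¹ • y, ?_, ?_⟩, rfl⟩
  · rw [mul_smul_comm, h₁, Algebra.smul_def, ← map_mul, inv_mul_cancel₀ hr, map_one]
  · rw [smul_mul_assoc, h₂, Algebra.smul_def, ← map_mul, inv_mul_cancel₀ hr, map_one]

theorem sym_add_real_eq_zero {x f : ℝ} {y : ℍ[ℝ]} (h : algebraMap ℝ Mat x + sym f y = 0) :
    x = 0 ∧ f = 0 ∧ y = 0 := by
  rw [mat_algebraMap] at h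
  have h0 := congrFun (congrFun h 0) 0
  have h1 := congrFun (congrFun h 0) 1
  have h3 := congrFun (congrFun h 1) 1
  simp [sym] at h0 h1 h3
  have h4 := congrArg (fun w : ℍ[ℝ] => w.re) h0
  have h5 := congrArg (fun w : ℍ[ℝ] => w.re) h3
  simp at h4 h5
  refine ⟨by linarith, by linarith, h1⟩

theorem smul_sym (r f : ℝ) (y : ℍ[ℝ]) : r • sym f y = sym (r * f) (r • y) := by
  apply Mat.ext <;> simp [sym, ← coe_mul_eq_smul]
  exact coe_commutes _ _

/-- Commuting elements of grade four are proportional. -/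
theorem sym_commute {f g : ℝ} {y z : ℍ[ℝ]} (hz : sym g z ≠ 0)
    (h : sym f y * sym g z = sym g z * sym f y) : ∃ μ : ℝ, sym f y = μ • sym g z := by
  have h0 := congrFun (congrFun h 0) 0
  have h1 := congrFun (congrFun h 0) 1
  simp [sym, Matrix.mul_apply, Fin.sum_univ_two] at h0 h1
  by_cases hg : g = 0
  · subst hg
    have hz0 : z ≠ 0 := by
      rintro rfl; apply hz; apply Mat.ext <;> simp [sym]
    have hn : normSq z ≠ 0 := normSq_ne_zero.2 hz0
    have hf : f = 0 := by
      simp at h1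
      have : (2 * f) • z = 0 := by
        rw [← coe_mul_eq_smul, Quaternion.coe_mul, mul_assoc]
        have h2 : (f : ℍ[ℝ]) * z = - (z * f) := by simpa using h1
        rw [← coe_commutes] at h2
        have : (2 : ℍ[ℝ]) * (f * z) = 0 := by
          rw [two_mul]; nth_rw 1 [h2]; simp
        exact_mod_cast this
      rcases smul_eq_zero.1 this with h | h
      · linarith
      · exact absurd h hz0
    subst hf
    simp at h0
    have hr : y * star z = ((y * star z).re : ℍ[ℝ]) := by
      rw [← star_eq_self]; simp [h0]
    refine ⟨(y * star z).re / normSq z, ?_⟩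
    have hy : y = ((y * star z).re / normSq z) • z := by
      have h5 : y * star z * z = (y * star z).re • z := by
        rw [← coe_mul_eq_smul, ← hr]
      rw [mul_assoc, star_mul_self, mul_coe_eq_smul] at h5
      rw [div_eq_inv_mul, mul_smul, ← h5, smul_smul, inv_mul_cancel₀ hn, one_smul]
    rw [smul_sym, mul_zero, ← hy]
  · refine ⟨f / g, ?_⟩
    have hy : y = (f / g) • z := by
      have h5 : (2 * g) • y = (2 * f) • z := by
        simp only [coe_mul_eq_smul, mul_coe_eq_smul] at h1
        rw [← sub_eq_zero] at h1 ⊢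
        rw [← neg_eq_zero, ← h1]
        module
      rw [mul_smul, mul_smul] at h5
      have h6 : g • y = f • z := smul_right_injective _ (two_ne_zero (α := ℝ)) h5
      rw [div_eq_inv_mul, mul_smul, ← h6, smul_smul, inv_mul_cancel₀ hg, one_smul]
    rw [smul_sym, div_mul_cancel₀ _ hg, ← hy]

/-! ### Elimination in the commutative algebra generated by a root -/

section Commuting

/-- The commutative core of the classification: the pair `B`, `C` belongs to a motion polynomial
`t² + t B + (q + C + W)`, and `c s + c μ * W` is the symmetric part of a root. -/
theorem eq_zero_of_commRing {R : Type*} [CommRing R] [Algebra ℝ R] {B W C E : R}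
    {s μ l γ q β ω : ℝ} {c : ℝ →+* R} (hcR : c = algebraMap ℝ R)
    (hW : ∀ x y : ℝ, c x + c y * W = 0 → x = 0 ∧ y = 0)
    (hW2 : W * W = c ω) (hB2 : B * B = c β + 2 * W) (hBC : B * C = c l)
    (hC2 : C * C = c γ + 2 * c q * W) (hσ : (c s + c μ * W) * E = -C)
    (hE : 4 * (c s + c μ * W) ^ 2 + E * E + 4 * c q + 2 * W - c β = 0)
    (hirr : (4 * (s ^ 2 + μ ^ 2 * ω) - β) ^ 2 = (8 * s * μ - 2) ^ 2 * ω)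
    (hN : 4 * ω ≤ β ^ 2) (hβ : 0 ≤ ω → β < 0) :
    C = 0 ∧ q = 0 ∧ β ^ 2 = 4 * ω := by
  -- Compare `(B * C)²` with `B² * C²` in the basis `1, W`.
  have h1 : β * γ + 4 * q * ω - l ^ 2 = 0 ∧ 2 * γ + 2 * q * β = 0 := by
    apply hW
    simp only [map_add, map_sub, map_mul, map_pow, map_ofNat]
    linear_combination (-(c β) - 2 * W) * hC2 - 4 * c q * hW2 - C * C * hB2 + 
      (B * C + c l) * hBC
  obtain ⟨h1, h2⟩ := h1
  -- The hypothesis `hirr` says that `4σ² - B²`, with `σ = s + μW`, has norm zero over `ℝ[W]`. For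
  -- `ω < 0` this algebra is a copy of `ℂ`, so `4σ² = B²`.
  rcases lt_or_ge ω 0 with hω | hω
  · exfalso
    have h3 : 8 * s * μ - 2 = 0 := by
      by_contra hne
      have : 0 < (8 * s * μ - 2) ^ 2 := by positivity
      nlinarith [sq_nonneg (4 * (s ^ 2 + μ ^ 2 * ω) - β)]
    have h4 : 4 * (s ^ 2 + μ ^ 2 * ω) - β = 0 := by
      rw [h3] at hirr; simpa using hirr
    have h3' := congrArg c h3
    have h4' := congrArg c h4
    simp only [map_add, map_sub, map_mul, map_pow, map_ofNat, map_zero] at h3' h4'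
    have h5 : 4 * (c s + c μ * W) ^ 2 = c β + 2 * W := by
      linear_combination h4' + W * h3' + 4 * c μ ^ 2 * hW2
    -- Now `hE` reads `E² = -4q - 4W`; substituting it into `4σ²E² = 4C²` and using `h1` leaves `ω =
    -- 0`.
    have h6 : -4 * q * β - 8 * ω - 4 * γ = 0 ∧ -4 * β - 8 * q - 8 * q = 0 := by
      apply hW
      simp only [map_sub, map_mul, map_ofNat, map_neg]
      linear_combination 8 * hW2 + 4 * hC2 + (c β + 2 * W - E * E) * h5 - (c β + 2 * W) * hE
        + 4 * ((c s + c μ * W) * E - C) * hσ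
    nlinarith [h6.1, h6.2]
  · have hβ' := hβ hω
    -- For `ω ≥ 0` the norm splits into the values at `W = ±√ω`; `w` is a value at which `4σ² - B²`
    -- vanishes. There `B²` becomes a square, while `hN` and `β < 0` make it nonpositive, so both
    -- sides are zero.
    obtain ⟨w, hw, hw2⟩ : ∃ w : ℝ, w ^ 2 = ω ∧
        4 * (s ^ 2 + μ ^ 2 * ω) - β + (8 * s * μ - 2) * w = 0 := by
      have h3 : Real.sqrt ω ^ 2 = ω := Real.sq_sqrt hω
      have h4 : (4 * (s ^ 2 + μ ^ 2 * ω) - β + (8 * s * μ - 2) * Real.sqrt ω) *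
          (4 * (s ^ 2 + μ ^ 2 * ω) - β + (8 * s * μ - 2) * -Real.sqrt ω) = 0 := by
        linear_combination hirr - (8 * s * μ - 2) ^ 2 * h3
      rcases mul_eq_zero.1 h4 with h | h
      · exact ⟨_, h3, h⟩
      · exact ⟨_, by rw [neg_sq, h3], h⟩
    have h3 : 4 * (s + μ * w) ^ 2 = β + 2 * w := by
      rw [← hw] at hw2; linear_combination hw2
    have h4 : β + 2 * w ≤ 0 := by
      by_contra! hlt
      nlinarith
    have h5 : β + 2 * w = 0 := le_antisymm h4 (by rw [← h3]; positivity)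
    have h6 : s = -(μ * w) := by
      have : (s + μ * w) ^ 2 = 0 := by linarith
      have := pow_eq_zero_iff (two_ne_zero) |>.1 this
      linarith
    have hβw : β = -2 * w := by linarith
    have hw0 : w ≠ 0 := by rintro rfl; linarith
    subst hw hβw h6
    -- Now `B² = 2(W - w)` is killed by `W + w`, hence so is `l² = B² * C²`.
    have hl : l = 0 := by
      have : l ^ 2 * (-2 * w) = 0 ∧ -2 * l ^ 2 = 0 := by
        apply hW
        simp only [map_mul, map_pow, map_ofNat, map_neg] at hB2 hW2 ⊢
        linear_combination (-(-2 * c w - 2 * W)) * (B * C + c l) * hBC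
          + (-2 * c w - 2 * W) * C * C * hB2 - 4 * C * C * hW2
      have := this.2
      simpa using this
    subst hl
    simp only [map_mul, map_pow, map_ofNat, map_neg, map_zero] at hB2 hW2 hBC hσ hC2
    have h7 : 2 * (W - c w) * C = 0 := by
      linear_combination B * hBC - C * hB2
    -- `C` is killed by `W - w` through `h7`, and by `W + w` because `σ = μ(W - w)` divides it.
    have h8 : c w * C = 0 := by
      have : 4 * (c w * C) = 0 := by
        linear_combination -h7 + (2 * (W - c w) + 4 * c w) * hσ - 2 * c μ * E * hW2
      have h9 : (4 : ℝ) • (c w * C) = 0 := by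
        rw [Algebra.smul_def, map_ofNat, this]
      simpa using h9
    have hC : C = 0 := by
      have : w • C = 0 := by rw [Algebra.smul_def, ← hcR, h8]
      exact (smul_eq_zero.1 this).resolve_left hw0
    subst hC
    refine ⟨rfl, ?_, by ring⟩
    have : γ = 0 ∧ 2 * q = 0 := by
      apply hW
      simp only [map_mul, map_ofNat]
      linear_combination -hC2
    linarith [this.2]

end Commuting

/-- Reduces a noncommutative situation to `eq_zero_of_commRing`: `h'` and `C` are polynomials in the
pairwise commuting `B`, `W`, `h`, so all the relations live in one commutative subalgebra. -/
theorem eq_zero_of_commute {A : Type*} [Ring A] [Algebra ℝ A] {B W C h h' : A}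
    {s μ l γ q β ω : ℝ} {c : ℝ →+* A} (hc : c = algebraMap ℝ A)
    (hW : ∀ x y : ℝ, c x + c y * W = 0 → x = 0 ∧ y = 0)
    (hW2 : W * W = c ω) (hB2 : B * B = c β + 2 * W) (hBC : B * C = c l)
    (hC2 : C * C = c γ + 2 * c q * W) (hBW : B * W = W * B) (hBh : B * h = h * B)
    (hWh : W * h = h * W) (hh' : h + h' = 2 * (c s + c μ * W))
    (hroot : h * h + B * h + (c q + C + W) = 0)
    (hroot' : h' * h' - B * h' + (c q - C + W) = 0)
    (hirr : ¬ IsUnit (h + h' - B))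
    (hN : 4 * ω ≤ β ^ 2) (hβ : 0 ≤ ω → β < 0) :
    C = 0 ∧ q = 0 ∧ β ^ 2 = 4 * ω := by
  let S : Set A := {B, W, h}
  have hcomm : ∀ a ∈ S, ∀ b ∈ S, a * b = b * a := by
    rintro a (rfl | rfl | rfl) b (rfl | rfl | rfl) <;>
      first | rfl | assumption | (symm; assumption)
  have hadj := Algebra.isMulCommutative_adjoin ℝ hcomm
  let : CommRing (Algebra.adjoin ℝ S) :=
    { (inferInstance : Ring (Algebra.adjoin ℝ S)) with mul_comm := hadj.is_comm.comm }
  let B₀ : Algebra.adjoin ℝ S := ⟨B, Algebra.subset_adjoin (by simp [S])⟩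
  let W₀ : Algebra.adjoin ℝ S := ⟨W, Algebra.subset_adjoin (by simp [S])⟩
  let h₀ : Algebra.adjoin ℝ S := ⟨h, Algebra.subset_adjoin (by simp [S])⟩
  let c₀ : ℝ →+* Algebra.adjoin ℝ S := algebraMap ℝ (Algebra.adjoin ℝ S)
  have hc₀ : ∀ r, (c₀ r : A) = c r := fun r => by rw [hc]; rfl
  let C₀ : Algebra.adjoin ℝ S := -(h₀ * h₀ + B₀ * h₀ + c₀ q + W₀)
  have hC₀ : (C₀ : A) = C := by
    have : C = -(h * h + B * h + c q + W) := by
      rw [eq_neg_iff_add_eq_zero, ← hroot]; abel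
    rw [this, ← hc₀]; rfl
  let k₀ : Algebra.adjoin ℝ S := 2 * (c₀ s + c₀ μ * W₀) - h₀
  have hk₀ : (k₀ : A) = h' := by
    have : h' = 2 * (c s + c μ * W) - h := by rw [← hh']; abel
    rw [this, ← hc₀, ← hc₀]; rfl
  have e₁ : h₀ * h₀ + B₀ * h₀ + (c₀ q + C₀ + W₀) = 0 := by
    simp only [C₀]; ring
  have e₂ : k₀ * k₀ - B₀ * k₀ + (c₀ q - C₀ + W₀) = 0 := by
    apply Subtype.ext
    have : (k₀ : A) * k₀ - B * k₀ + (c₀ q - C₀ + W) = 0 := by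
      rw [hk₀, hC₀, hc₀, hroot']
    exact this
  have e₃ : W₀ * W₀ = c₀ ω := Subtype.ext ((hc₀ ω).symm ▸ hW2)
  have e₄ : B₀ * B₀ = c₀ β + 2 * W₀ := Subtype.ext (by
    have : B * B = c₀ β + 2 * W := by rw [hc₀, hB2]
    exact this)
  have e₅ : B₀ * C₀ = c₀ l := Subtype.ext (by
    have : B * C₀ = c₀ l := by rw [hc₀, hC₀, hBC]
    exact this)
  have e₆ : C₀ * C₀ = c₀ γ + 2 * c₀ q * W₀ := Subtype.ext (by
    have : (C₀ : A) * C₀ = c₀ γ + 2 * c₀ q * W := by rw [hc₀, hc₀, hC₀, hC2]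
    exact this)
  have hk : k₀ = 2 * (c₀ s + c₀ μ * W₀) - h₀ := rfl
  have key := eq_zero_of_commRing (R := Algebra.adjoin ℝ S) (B := B₀) (W := W₀) (C := C₀)
    (E := h₀ - k₀ + B₀) (s := s) (μ := μ) (l := l) (γ := γ) (q := q) (β := β) (ω := ω)
    (c := c₀) rfl ?_ e₃ e₄ e₅ e₆ ?_ ?_ ?_ hN hβ
  · refine ⟨?_, key.2⟩
    rw [← hC₀, key.1]; rfl
  · intro x y hxy
    apply hW
    rw [← hc₀, ← hc₀]
    exact congrArg Subtype.val hxy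
  · have : (2 : ℝ) • ((c₀ s + c₀ μ * W₀) * (h₀ - k₀ + B₀) + C₀) = 0 := by
      rw [Algebra.smul_def, map_ofNat]
      rw [hk] at e₂ ⊢
      linear_combination e₁ - e₂
    rw [eq_neg_iff_add_eq_zero]
    exact (smul_eq_zero.1 this).resolve_left two_ne_zero
  · rw [hk] at e₂ ⊢
    linear_combination 2 * e₁ + 2 * e₂ + e₄
  · by_contra hne
    apply hirr
    -- The first factor turns `h + h' - B` into `4σ² - B²`, an element of `ℝ[W]`; the second is its
    -- conjugate under `W ↦ -W`. The product is the norm `r`, which would make `h + h' - B` a unit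
    -- if nonzero.
    let z : Algebra.adjoin ℝ S := (h₀ + k₀ + B₀) *
      (c₀ (4 * (s ^ 2 + μ ^ 2 * ω) - β) - c₀ (8 * s * μ - 2) * W₀)
    let r := (4 * (s ^ 2 + μ ^ 2 * ω) - β) ^ 2 - (8 * s * μ - 2) ^ 2 * ω
    have hz : (h₀ + k₀ - B₀) * z = c₀ r := by
      simp only [z, r, hk, map_add, map_sub, map_mul, map_pow, map_ofNat]
      linear_combination (4 * (c₀ s ^ 2 + c₀ μ ^ 2 * c₀ ω) - c₀ β -
        (8 * c₀ s * c₀ μ - 2) * W₀) * (4 * c₀ μ ^ 2 * e₃ - e₄) 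
        - (8 * c₀ s * c₀ μ - 2) ^ 2 * e₃
    have hz' : (h + h' - B) * z = c r := by
      rw [← hk₀, ← hc₀, ← hz]; rfl
    have hz'' : (z : A) * (h + h' - B) = c r := by
      rw [← hk₀, ← hc₀, ← hz, mul_comm]; rfl
    rw [hc] at hz' hz''
    exact isUnit_of_mul_eq (sub_ne_zero.2 hne) hz' hz''

/-! ### Squares of skew-adjoint matrices and their norm inequalities -/

/-- The traceless self-adjoint part of `2⁻¹ * B * B` for a skew-adjoint `B`. -/
def wedge (p m q : ℍ[ℝ]) : Mat :=
  sym ((normSq q - normSq p) / 4) ((2⁻¹ : ℝ) • (p * m + m * q))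

theorem skew_sq {p m q : ℍ[ℝ]} (hp : star p = -p) (hq : star q = -q) :
    !![p, m; star m, q] * !![p, m; star m, q] =
      algebraMap ℝ Mat (normSq m - (normSq p + normSq q) / 2) + 2 * wedge p m q := by
  have hpp : p * p = ((-normSq p : ℝ) : ℍ[ℝ]) := by
    rw [Quaternion.coe_neg, ← self_mul_star, hp]; simp
  have hqq : q * q = ((-normSq q : ℝ) : ℍ[ℝ]) := by
    rw [Quaternion.coe_neg, ← self_mul_star, hq]; simp
  have h2 : (2 : Mat) * wedge p m q = (2 : ℝ) • wedge p m q := by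
    rw [Algebra.smul_def, map_ofNat]
  rw [h2, wedge, smul_sym, mat_algebraMap, smul_smul, mul_inv_cancel₀ two_ne_zero, one_smul]
  apply Mat.ext
  · simp [sym, Matrix.mul_apply, Fin.sum_univ_two, self_mul_star, hpp]
    norm_cast
    congr 1
    ring
  · simp [sym, Matrix.mul_apply, Fin.sum_univ_two]
  · simp [sym, Matrix.mul_apply, Fin.sum_univ_two, hp, hq]
    abel
  · simp [sym, Matrix.mul_apply, Fin.sum_univ_two, star_mul_self, hqq]
    norm_cast
    congr 1
    ring

theorem normSq_eq_norm_sq (x : ℍ[ℝ]) : normSq x = ‖x‖ ^ 2 := by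
  rw [normSq_eq_norm_mul_self, sq]

/-- The reverse triangle inequality for `p * m` and `-(m * q)`, with multiplicativity of the norm.
-/
theorem le_normSq_add (p m q : ℍ[ℝ]) :
    ‖m‖ ^ 2 * (‖p‖ - ‖q‖) ^ 2 / 4 ≤ normSq ((2⁻¹ : ℝ) • (p * m + m * q)) := by
  rw [normSq_smul, normSq_eq_norm_sq]
  have h := abs_norm_sub_norm_le (p * m) (-(m * q))
  rw [norm_neg, norm_mul, norm_mul, sub_neg_eq_add] at h
  have h2 := sq_le_sq' (by linarith [neg_abs_le (‖p‖ * ‖m‖ - ‖m‖ * ‖q‖), norm_nonneg (p * m + m * q)]) (le_of_abs_le h)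
  nlinarith

section Wedge
variable (p m q : ℍ[ℝ])

/-- By `le_normSq_add`, right side minus left side is at least `(‖m‖² - ‖p‖‖q‖)²`. -/
theorem four_mul_le_sq :
    4 * (((normSq q - normSq p) / 4) ^ 2 - normSq ((2⁻¹ : ℝ) • (p * m + m * q))) ≤
      (normSq m - (normSq p + normSq q) / 2) ^ 2 := by
  have h := le_normSq_add p m q
  simp only [normSq_eq_norm_sq _] at h ⊢
  nlinarith [sq_nonneg (‖m‖ ^ 2 - ‖p‖ * ‖q‖)]

theorem wedge_eq_zero (h : ((normSq q - normSq p) / 4) ^ 2 -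
    normSq ((2⁻¹ : ℝ) • (p * m + m * q)) ≥ 0) (hg : normSq q = normSq p) : wedge p m q = 0 := by
  have h0 : normSq ((2⁻¹ : ℝ) • (p * m + m * q)) = 0 := by
    rw [hg] at h
    have := normSq_nonneg (a := (2⁻¹ : ℝ) • (p * m + m * q))
    linarith
  rw [normSq_eq_zero] at h0
  rw [wedge, h0, hg]
  apply Mat.ext <;> simp [sym]

/-- Here `‖p‖ ≠ ‖q‖`, so `(‖p‖ - ‖q‖)²` can be cancelled from the hypothesis after `le_normSq_add`.
This gives `‖m‖² ≤ (‖p‖ + ‖q‖)² / 4`, which is less than `(‖p‖² + ‖q‖²) / 2`. -/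
theorem trace_neg (hw : wedge p m q ≠ 0) (h : ((normSq q - normSq p) / 4) ^ 2 -
    normSq ((2⁻¹ : ℝ) • (p * m + m * q)) ≥ 0) : normSq m - (normSq p + normSq q) / 2 < 0 := by
  have hg : normSq q ≠ normSq p := fun hg => hw (wedge_eq_zero p m q h hg)
  have h1 := le_normSq_add p m q
  generalize normSq ((2⁻¹ : ℝ) • (p * m + m * q)) = n at *
  simp only [normSq_eq_norm_sq _] at h1 h hg ⊢
  have hp := norm_nonneg p
  have hq := norm_nonneg q
  have hd : 0 < (‖p‖ - ‖q‖) ^ 2 := by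
    apply sq_pos_of_ne_zero
    intro h0
    apply hg
    rw [sub_eq_zero.1 h0]
  have h2 : ‖m‖ ^ 2 ≤ (‖p‖ + ‖q‖) ^ 2 / 4 := by
    by_contra! hlt
    nlinarith
  nlinarith

/-- Equality in `four_mul_le_sq` forces equality in both estimates behind it: the discarded square
and the reverse triangle inequality. -/
theorem extremal (h : (normSq m - (normSq p + normSq q) / 2) ^ 2 =
    4 * (((normSq q - normSq p) / 4) ^ 2 - normSq ((2⁻¹ : ℝ) • (p * m + m * q)))) :
    ‖m‖ ^ 2 = ‖p‖ * ‖q‖ ∧ ‖p * m + m * q‖ ^ 2 = ‖m‖ ^ 2 * (‖p‖ - ‖q‖) ^ 2 := by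
  have h1 := le_normSq_add p m q
  rw [normSq_smul] at h h1
  simp only [normSq_eq_norm_sq _] at h1 h
  have h2 : (‖m‖ ^ 2 - ‖p‖ * ‖q‖) ^ 2 = 0 := by
    nlinarith [sq_nonneg (‖m‖ ^ 2 - ‖p‖ * ‖q‖)]
  have h3 := pow_eq_zero_iff (two_ne_zero) |>.1 h2
  exact ⟨by linarith, by nlinarith⟩

end Wedge

/-! ### Diagonalization of extremal skew-adjoint matrices -/

/-- `a` intertwines `x` and `y` and is a displacement. -/
def Intertwines (a x y : Mat) : Prop :=
  a * x = y * a ∧ ∃ r : ℝ, r ≠ 0 ∧ a * rv a = algebraMap ℝ Mat r ∧ rv a * a = algebraMap ℝ Mat r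

theorem Intertwines.trans {a b x y z : Mat} (h₁ : Intertwines a x y) (h₂ : Intertwines b y z) :
    Intertwines (b * a) x z := by
  obtain ⟨h₁, r, hr, h₃, h₄⟩ := h₁
  obtain ⟨h₂, s, hs, h₅, h₆⟩ := h₂
  refine ⟨by rw [mul_assoc, h₁, ← mul_assoc, h₂, mul_assoc], s * r, mul_ne_zero hs hr, ?_, ?_⟩
  · rw [rv_mul, mul_assoc, ← mul_assoc a, h₃, ← mul_assoc, ← Algebra.commutes, mul_assoc, h₅,
      mul_comm s, map_mul]
  · rw [rv_mul, mul_assoc, ← mul_assoc _ b, h₆, ← mul_assoc, ← Algebra.commutes, mul_assoc, h₄,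
      map_mul]

/-- Equality in the reverse triangle inequality makes `p * m` and `m * q` point in opposite
directions; multiply that relation by `star m` on the right. The result is what makes the matrix
singular. -/
theorem normSq_smul_eq_neg {p m q : ℍ[ℝ]} (hm : ‖m‖ ^ 2 = ‖p‖ * ‖q‖)
    (hz : ‖p * m + m * q‖ ^ 2 = ‖m‖ ^ 2 * (‖p‖ - ‖q‖) ^ 2) :
    normSq q • p = -(m * q * star m) := by
  by_cases hp : p = 0
  · subst hp
    have : m = 0 := by simpa using hm
    simp [this]
  have hp' : ‖p‖ ≠ 0 := norm_ne_zero_iff.2 hp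
  have h1 : ‖q‖ • (p * m) + ‖p‖ • (m * q) = 0 := by
    rw [← normSq_eq_zero, normSq_add]
    rw [← normSq_eq_norm_sq, normSq_add] at hz
    simp only [normSq_smul, Quaternion.star_smul, smul_mul_smul_comm, re_smul, map_mul, smul_eq_mul]
      at hz ⊢
    simp only [normSq_eq_norm_sq _] at hz ⊢
    linear_combination (‖p‖ * ‖q‖) * hz
  have h2 := congrArg (· * star m) h1
  simp only [add_mul, smul_mul_assoc, zero_mul] at h2
  rw [mul_assoc p, self_mul_star, mul_coe_eq_smul, normSq_eq_norm_sq, hm, smul_smul] at h2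
  have h3 : ‖p‖ • (normSq q • p + m * q * star m) = 0 := by
    rw [← h2, smul_add, smul_smul, normSq_eq_norm_sq]
    congr 2
    ring
  exact eq_neg_of_add_eq_zero_left ((smul_eq_zero.1 h3).resolve_left hp')

theorem exists_intertwines_diag_of_lt {p m q : ℍ[ℝ]} (hq : star q = -q)
    (hm : ‖m‖ ^ 2 = ‖p‖ * ‖q‖)
    (hz : ‖p * m + m * q‖ ^ 2 = ‖m‖ ^ 2 * (‖p‖ - ‖q‖) ^ 2) (hlt : ‖p‖ < ‖q‖) :
    ∃ (a : Mat) (x : ℍ[ℝ]), x ≠ 0 ∧ star x = -x ∧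
      Intertwines a !![p, m; star m, q] !![0, 0; 0, x] := by
  have key := normSq_smul_eq_neg hm hz
  have hq0 : 0 < ‖q‖ := (norm_nonneg p).trans_lt hlt
  have hn : normSq q ≠ 0 := by rw [normSq_eq_norm_sq]; positivity
  have hmn : normSq m < normSq q := by
    rw [normSq_eq_norm_sq, normSq_eq_norm_sq, hm, sq]
    exact mul_lt_mul_of_pos_right hlt hq0
  have hqq : q * q = ((-normSq q : ℝ) : ℍ[ℝ]) := by
    rw [Quaternion.coe_neg, ← self_mul_star, hq]; simp
  have hqmm : q * star m * (m * q) = ((-(normSq m * normSq q) : ℝ) : ℍ[ℝ]) := by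
    rw [mul_assoc, ← mul_assoc (star m), star_mul_self, coe_mul_eq_smul, mul_smul_comm, hqq,
      smul_coe]
    congr 1; ring
  have hmqm : m * q * (q * star m) = ((-(normSq m * normSq q) : ℝ) : ℍ[ℝ]) := by
    rw [mul_assoc, ← mul_assoc q, hqq, coe_mul_eq_smul, mul_smul_comm, self_mul_star, smul_coe]
    congr 1; ring
  have hx : (1 - normSq m / normSq q) ≠ 0 := by
    rw [sub_ne_zero]
    intro h
    rw [eq_div_iff hn] at h
    linarith
  have hr : normSq q ^ 2 - normSq m * normSq q ≠ 0 := by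
    have : 0 < normSq q := lt_of_le_of_ne normSq_nonneg hn.symm
    nlinarith
  have hmm : star m * m = ((normSq m : ℝ) : ℍ[ℝ]) := star_mul_self m
  -- The first row spans the left kernel of the matrix and the second is orthogonal to it for the
  -- hermitian form. Their norms are opposite, and nonzero because `‖m‖ < ‖q‖`.
  refine ⟨!![((normSq q : ℝ) : ℍ[ℝ]), m * q; -(q * star m), ((normSq q : ℝ) : ℍ[ℝ])],
    (1 - normSq m / normSq q) • q, ?_, ?_, ?_, _, hr, ?_, ?_⟩
  · exact smul_ne_zero hx (normSq_ne_zero.1 hn)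
  · rw [Quaternion.star_smul, hq, smul_neg]
  · apply Mat.ext
    · simp [Matrix.mul_apply, Fin.sum_univ_two, coe_mul_eq_smul, key]
    · simp [Matrix.mul_apply, Fin.sum_univ_two, coe_mul_eq_smul, mul_assoc, hqq, mul_coe_eq_smul]
    · have : q * star m * p = (normSq q)⁻¹ • (q * star m * (normSq q • p)) := by
        rw [mul_smul_comm, smul_smul, inv_mul_cancel₀ hn, one_smul]
      simp only [Matrix.mul_apply, Fin.sum_univ_two, Matrix.of_apply, Matrix.cons_val',
        Matrix.cons_val_zero, Matrix.cons_val_one, Matrix.cons_val_fin_one]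
      rw [neg_mul, this, key, mul_neg, ← mul_assoc, hqmm, coe_mul_eq_smul, coe_mul_eq_smul,
        zero_mul, zero_add, smul_mul_assoc, mul_neg, ← mul_assoc, hqq, coe_mul_eq_smul, 
        ← neg_smul, ← neg_smul, smul_neg, neg_neg, smul_smul, ← add_smul, ← neg_smul, smul_smul]
      congr 1
      field_simp
      ring
    · simp only [Matrix.mul_apply, Fin.sum_univ_two, Matrix.of_apply, Matrix.cons_val',
        Matrix.cons_val_zero, Matrix.cons_val_one, Matrix.cons_val_fin_one]
      rw [neg_mul, mul_assoc, hmm, coe_mul_eq_smul, mul_coe_eq_smul, mul_coe_eq_smul, zero_mul,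
        zero_add, smul_smul, ← neg_smul, ← add_smul]
      congr 1
      field_simp
      ring
  · rw [mat_algebraMap]
    apply Mat.ext
    · simp only [rv, Matrix.mul_apply, Fin.sum_univ_two, Matrix.of_apply, Matrix.cons_val',
        Matrix.cons_val_zero, Matrix.cons_val_one, Matrix.cons_val_fin_one, star_coe, star_neg,
        star_mul, star_star, hq, neg_mul, mul_neg, neg_neg]
      rw [hmqm, ← Quaternion.coe_mul, ← Quaternion.coe_add]
      congr 1; ring
    · simp [rv, Matrix.mul_apply, Fin.sum_univ_two, hq, coe_mul_eq_smul, mul_coe_eq_smul]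
    · simp [rv, Matrix.mul_apply, Fin.sum_univ_two, hq, coe_mul_eq_smul, mul_coe_eq_smul]
    · simp only [rv, Matrix.mul_apply, Fin.sum_univ_two, Matrix.of_apply, Matrix.cons_val',
        Matrix.cons_val_zero, Matrix.cons_val_one, Matrix.cons_val_fin_one, star_coe, star_neg,
        star_mul, star_star, hq, neg_mul, mul_neg, neg_neg]
      rw [hqmm, ← Quaternion.coe_mul, ← Quaternion.coe_add]
      congr 1; ring
  · rw [mat_algebraMap]
    apply Mat.ext
    · simp only [rv, Matrix.mul_apply, Fin.sum_univ_two, Matrix.of_apply, Matrix.cons_val',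
        Matrix.cons_val_zero, Matrix.cons_val_one, Matrix.cons_val_fin_one, star_coe, star_neg,
        star_mul, star_star, hq, neg_mul, mul_neg, neg_neg]
      rw [hmqm, ← Quaternion.coe_mul, ← Quaternion.coe_add]
      congr 1; ring
    · simp [rv, Matrix.mul_apply, Fin.sum_univ_two, hq, coe_mul_eq_smul, mul_coe_eq_smul]
    · simp [rv, Matrix.mul_apply, Fin.sum_univ_two, hq, coe_mul_eq_smul, mul_coe_eq_smul]
    · simp only [rv, Matrix.mul_apply, Fin.sum_univ_two, Matrix.of_apply, Matrix.cons_val',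
        Matrix.cons_val_zero, Matrix.cons_val_one, Matrix.cons_val_fin_one, star_coe, star_neg,
        star_mul, star_star, hq, neg_mul, mul_neg, neg_neg]
      rw [hqmm, ← Quaternion.coe_mul, ← Quaternion.coe_add]
      congr 1; ring

theorem exists_intertwines_diag {p m q : ℍ[ℝ]} (hp : star p = -p) (hq : star q = -q)
    (hm : ‖m‖ ^ 2 = ‖p‖ * ‖q‖)
    (hz : ‖p * m + m * q‖ ^ 2 = ‖m‖ ^ 2 * (‖p‖ - ‖q‖) ^ 2) (hne : ‖p‖ ≠ ‖q‖) :
    ∃ (a : Mat) (x : ℍ[ℝ]), x ≠ 0 ∧ star x = -x ∧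
      Intertwines a !![p, m; star m, q] !![0, 0; 0, x] := by
  rcases lt_or_gt_of_ne hne with h | h
  · exact exists_intertwines_diag_of_lt hq hm hz h
  · have hz' : ‖q * star m + star m * p‖ ^ 2 = ‖star m‖ ^ 2 * (‖q‖ - ‖p‖) ^ 2 := by
      have : q * star m + star m * p = -star (p * m + m * q) := by
        simp [hp, hq, add_comm]
      rw [this, norm_neg, norm_star, hz, norm_star]
      ring
    obtain ⟨a, x, hx, hx', ha⟩ := exists_intertwines_diag_of_lt (p := q) (m := star m) (q := p)
      hp (by rw [norm_star, hm, mul_comm]) hz' h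
    -- Exchanging the two coordinates reverses the hermitian form, whence the quadrance `-1`.
    refine ⟨_, x, hx, hx', Intertwines.trans (a := !![0, 1; 1, 0]) ⟨?_, -1, by norm_num, ?_, ?_⟩ ha⟩
    · apply Mat.ext <;> simp [Matrix.mul_apply, Fin.sum_univ_two]
    · rw [mat_algebraMap]
      apply Mat.ext <;> simp [rv, Matrix.mul_apply, Fin.sum_univ_two]
    · rw [mat_algebraMap]
      apply Mat.ext <;> simp [rv, Matrix.mul_apply, Fin.sum_univ_two]

/-- The quaternion unit `k`. -/
def qk : ℍ[ℝ] := ⟨0, 0, 0, 1⟩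

theorem qk_sq : qk * qk = -1 := by apply Quaternion.ext <;> simp <;> simp [qk]

theorem exists_intertwines_qk {x : ℍ[ℝ]} (hx : x ≠ 0) (hx' : star x = -x) :
    ∃ (a : Mat) (c : ℝ), c ≠ 0 ∧ Intertwines a !![0, 0; 0, x] (c • !![0, 0; 0, -2 * qk]) := by
  have hn : ‖x‖ ≠ 0 := norm_ne_zero_iff.2 hx
  -- The half-way element `‖x‖k + x` rotates `x` to `‖x‖k`; it vanishes only when `x` is already a
  -- negative multiple of `k`.
  obtain ⟨d, y, hd, hy, hdy⟩ : ∃ (d : ℍ[ℝ]) (y : ℝ), d ≠ 0 ∧ y ≠ 0 ∧ d * x = y • (qk * d) := by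
    by_cases h : ‖x‖ • qk + x = 0
    · refine ⟨1, -‖x‖, one_ne_zero, neg_ne_zero.2 hn, ?_⟩
      rw [one_mul, mul_one, neg_smul]
      exact eq_neg_of_add_eq_zero_right h
    · refine ⟨‖x‖ • qk + x, ‖x‖, h, hn, ?_⟩
      have hxx : x * x = ((-‖x‖ ^ 2 : ℝ) : ℍ[ℝ]) := by
        rw [← normSq_eq_norm_sq, Quaternion.coe_neg, ← self_mul_star, hx']; simp
      rw [add_mul, mul_add, hxx, mul_smul_comm, qk_sq, smul_add, smul_smul, smul_mul_assoc,
        add_comm]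
      congr 1
      rw [smul_neg, Quaternion.coe_neg, ← sq, ← mul_one (((‖x‖ ^ 2 : ℝ) : ℍ[ℝ])), coe_mul_eq_smul]
  have hdd : ‖d‖ * ‖d‖ = normSq d := by rw [normSq_eq_norm_sq, sq]
  -- The entry `‖d‖` balances `d`, so that the quadrance is a scalar matrix.
  refine ⟨!![(‖d‖ : ℍ[ℝ]), 0; 0, d], -(y / 2), by simpa using hy, ?_, normSq d,
    normSq_ne_zero.2 hd, ?_, ?_⟩
  · apply Mat.ext <;> simp [Matrix.mul_apply, Fin.sum_univ_two]
    rw [hdy, mul_assoc]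
    rw [show (2 : ℍ[ℝ]) * (qk * d) = (2 : ℝ) • (qk * d) by rw [← coe_mul_eq_smul]; rfl, smul_smul]
    congr 1; ring
  · rw [mat_algebraMap]
    apply Mat.ext <;> simp [rv, Matrix.mul_apply, Fin.sum_univ_two, self_mul_star]
    rw [← Quaternion.coe_mul, hdd]
  · rw [mat_algebraMap]
    apply Mat.ext <;> simp [rv, Matrix.mul_apply, Fin.sum_univ_two, star_mul_self]
    rw [← Quaternion.coe_mul, hdd]

/-! ### Nilpotent linear coefficient -/

/-- A vanishing condition for the symmetric part of a non-invertible element. -/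
theorem normSq_eq_of_not_isUnit {B h : Mat} (hB2 : B * B = 0) (hB : rv B = -B)
    (hBh : B * h = h * B) (hirr : ¬ IsUnit (h + rv h - B)) :
    (2 * (h 0 0).re) * (2 * (h 1 1).re) + normSq (h 0 1 - star (h 1 0)) = 0 := by
  have hBh' : B * rv h = rv h * B := by
    have := congrArg rv hBh
    rw [rv_mul, rv_mul, hB, mul_neg, neg_mul, neg_inj] at this
    exact this.symm
  have hS : rv (h + rv h) = h + rv h := by rw [rv_add, rv_rv, add_comm]
  have hSB : B * (h + rv h) = (h + rv h) * B := by rw [mul_add, add_mul, hBh, hBh']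
  have e00 : (h + rv h) 0 0 = ((2 * (h 0 0).re : ℝ) : ℍ[ℝ]) := by
    simp only [Matrix.add_apply, rv, Matrix.of_apply, Matrix.cons_val',
      Matrix.cons_val_zero, Matrix.cons_val_fin_one]
    exact self_add_star' _
  have e11 : (h + rv h) 1 1 = ((2 * (h 1 1).re : ℝ) : ℍ[ℝ]) := by
    simp only [Matrix.add_apply, rv, Matrix.of_apply, Matrix.cons_val',
      Matrix.cons_val_one, Matrix.cons_val_fin_one]
    exact self_add_star' _
  have e01 : (h + rv h) 0 1 = h 0 1 - star (h 1 0) := by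
    simp [rv, sub_eq_add_neg]
  generalize h + rv h = S at *
  obtain ⟨s, f, y, rfl⟩ := exists_eq_of_rv_eq hS
  have f00 : s + f = 2 * (h 0 0).re := by
    have := congrArg (fun w : ℍ[ℝ] => w.re) e00
    simpa [mat_algebraMap, sym] using this
  have f11 : s - f = 2 * (h 1 1).re := by
    have := congrArg (fun w : ℍ[ℝ] => w.re) e11
    simpa [mat_algebraMap, sym, sub_eq_add_neg] using this
  have f01 : y = h 0 1 - star (h 1 0) := by
    rw [← e01]; simp [mat_algebraMap, sym]
  by_contra hne
  apply hirr
  have hne' : s ^ 2 - (f ^ 2 - normSq y) ≠ 0 := by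
    rw [← f00, ← f11, ← f01] at hne
    intro h0; apply hne; linear_combination h0
  have hcomm : algebraMap ℝ Mat s * sym f y = sym f y * algebraMap ℝ Mat s :=
    Algebra.commutes _ _
  have hU : IsUnit (algebraMap ℝ Mat s + sym f y) := by
    apply isUnit_of_mul_eq (y := algebraMap ℝ Mat s - sym f y) hne'
    · rw [mul_sub, add_mul, add_mul, sym_sq, hcomm, map_sub (algebraMap ℝ Mat) (s ^ 2), sq s, map_mul]; abel
    · rw [sub_mul, mul_add, mul_add, sym_sq, hcomm, map_sub (algebraMap ℝ Mat) (s ^ 2), sq s, map_mul]; abel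
  generalize algebraMap ℝ Mat s + sym f y = S at *
  have hc : Commute (S - B) (S + B) := by
    rw [Commute, SemiconjBy, sub_mul, mul_add, mul_add, mul_sub, add_mul, add_mul, hSB]
  -- With `B² = 0` and `S` commuting with `B`, `(S - B)(S + B) = S²`, so invertibility of `S` would
  -- pass to `S - B`.
  refine (hc.isUnit_mul_iff.1 ?_).1
  have : (S - B) * (S + B) = S * S := by
    rw [sub_mul, mul_add, mul_add, hSB, hB2]; abel
  rw [this]
  exact hU.mul hU

theorem cross_eq_zero {p₁ p₂ p₃ r₁ r₂ r₃ c₁ c₂ c₃ : ℝ} (u₁ : c₂ * p₃ - c₃ * p₂ = 0)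
    (u₂ : c₃ * p₁ - c₁ * p₃ = 0) (u₃ : c₁ * p₂ - c₂ * p₁ = 0) (v₁ : c₂ * r₃ - c₃ * r₂ = 0)
    (v₂ : c₃ * r₁ - c₁ * r₃ = 0) (v₃ : c₁ * r₂ - c₂ * r₁ = 0)
    (hc : c₁ ^ 2 + c₂ ^ 2 + c₃ ^ 2 ≠ 0) : p₁ * r₂ - p₂ * r₁ = 0 := by
  refine (mul_eq_zero.1 ?_).resolve_right hc
  linear_combination (c₁ * p₁ + c₂ * p₂) * v₃ - (c₁ * r₁ + c₂ * r₂) * u₃ + c₂ * r₃ * u₂ -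
    c₁ * p₃ * v₁ - c₂ * p₃ * v₂ + c₁ * r₃ * u₁ - (c₃ * p₁ - c₁ * p₃) * v₁ +
    (c₂ * p₃ - c₃ * p₂) * v₂

/-- The relation with `p` reads `(re c) p + (im c) × p = 0`. The two terms are orthogonal, so `c` is
purely imaginary and parallel to `p`; likewise to `r`. -/
theorem exists_smul_of_commute {c p r : ℍ[ℝ]} (hc : c ≠ 0) (hp : p ≠ 0) (hp0 : star p = -p)
    (hr0 : star r = -r) (hcp : c * p = -(p * star c)) (hcr : c * r = -(r * star c)) :
    ∃ ν : ℝ, r = ν • p := by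
  rw [star_eq_neg] at hp0 hr0
  have hn : normSq p ≠ 0 := normSq_ne_zero.2 hp
  have hcn : normSq c ≠ 0 := normSq_ne_zero.2 hc
  have p1 := congrArg (fun w : ℍ[ℝ] => w.imI) hcp
  have p2 := congrArg (fun w : ℍ[ℝ] => w.imJ) hcp
  have p3 := congrArg (fun w : ℍ[ℝ] => w.imK) hcp
  have r1 := congrArg (fun w : ℍ[ℝ] => w.imI) hcr
  have r2 := congrArg (fun w : ℍ[ℝ] => w.imJ) hcr
  have r3 := congrArg (fun w : ℍ[ℝ] => w.imK) hcr
  simp [hp0] at p1 p2 p3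
  simp [hr0] at r1 r2 r3
  rw [normSq_def', hp0] at hn
  have hc0 : c.re = 0 := by
    have : c.re * (0 ^ 2 + p.imI ^ 2 + p.imJ ^ 2 + p.imK ^ 2) = 0 := by
      linear_combination (p.imI * p1 + p.imJ * p2 + p.imK * p3) / 2
    exact (mul_eq_zero.1 this).resolve_right hn
  rw [normSq_def', hc0] at hcn
  rw [hc0] at p1 p2 p3 r1 r2 r3
  have u1 : c.imJ * p.imK - c.imK * p.imJ = 0 := by linarith
  have u2 : c.imK * p.imI - c.imI * p.imK = 0 := by linarith
  have u3 : c.imI * p.imJ - c.imJ * p.imI = 0 := by linarith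
  have v1 : c.imJ * r.imK - c.imK * r.imJ = 0 := by linarith
  have v2 : c.imK * r.imI - c.imI * r.imK = 0 := by linarith
  have v3 : c.imI * r.imJ - c.imJ * r.imI = 0 := by linarith
  have x12 := cross_eq_zero u1 u2 u3 v1 v2 v3 (by intro h; apply hcn; linear_combination h)
  have x23 := cross_eq_zero u2 u3 u1 v2 v3 v1 (by intro h; apply hcn; linear_combination h)
  have x13 := cross_eq_zero u3 u1 u2 v3 v1 v2 (by intro h; apply hcn; linear_combination h)
  refine ⟨(p.imI * r.imI + p.imJ * r.imJ + p.imK * r.imK) /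
    (0 ^ 2 + p.imI ^ 2 + p.imJ ^ 2 + p.imK ^ 2), ?_⟩
  apply Quaternion.ext
  · simp [hp0, hr0]
  · rw [imI_smul, smul_eq_mul, div_mul_eq_mul_div, eq_div_iff hn]
    linear_combination -p.imJ * x12 + p.imK * x13
  · rw [imJ_smul, smul_eq_mul, div_mul_eq_mul_div, eq_div_iff hn]
    linear_combination p.imI * x12 - p.imK * x23
  · rw [imK_smul, smul_eq_mul, div_mul_eq_mul_div, eq_div_iff hn]
    linear_combination -p.imI * x13 + p.imJ * x23

theorem exists_smul_of_null_std {p r : ℍ[ℝ]} {h : Mat} {q : ℝ} (hp : p ≠ 0) (hp0 : star p = -p)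
    (hr0 : star r = -r) (hB : !![p, p; -p, -p] * h = h * !![p, p; -p, -p])
    (hC : !![r, r; -r, -r] * h = h * !![r, r; -r, -r])
    (hroot : h * h + !![p, p; -p, -p] * h + (algebraMap ℝ Mat q + !![r, r; -r, -r]) = 0)
    (hirr : ¬ IsUnit (h + rv h - !![p, p; -p, -p])) : ∃ ν : ℝ, r = ν • p := by
  have hn := normSq_eq_of_not_isUnit (B := !![p, p; -p, -p])
    (by apply Mat.ext <;> simp [Matrix.mul_apply, Fin.sum_univ_two])
    (by apply Mat.ext <;> simp [rv, hp0]) hB hirr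
  have b00 := congrFun (congrFun hB 0) 0
  have b01 := congrFun (congrFun hB 0) 1
  have c00 := congrFun (congrFun hC 0) 0
  simp [Matrix.mul_apply, Fin.sum_univ_two] at b00 b01 c00
  have hk : h 1 0 = h 0 1 + h 1 1 - h 0 0 := by
    have : p * (h 0 0 + h 1 0) = p * (h 0 1 + h 1 1) := by
      rw [mul_add, mul_add, b00, b01]
    have := mul_left_cancel₀ hp this
    rw [← this]; abel
  have hre : (h 1 1).re = -(h 0 0).re ∧ (h 0 1).imI = -(h 1 0).imI ∧
      (h 0 1).imJ = -(h 1 0).imJ ∧ (h 0 1).imK = -(h 1 0).imK := by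
    have hkr : (h 1 0).re = (h 0 1).re + (h 1 1).re - (h 0 0).re := by rw [hk]; simp
    rw [normSq_def'] at hn
    simp [hkr] at hn
    -- Once `hkr` eliminates the real part of `h 1 0`, the indefinite norm condition becomes a sum
    -- of four squares.
    have : ((h 1 1).re + (h 0 0).re) ^ 2 + ((h 0 1).imI + (h 1 0).imI) ^ 2
      + ((h 0 1).imJ + (h 1 0).imJ) ^ 2 + ((h 0 1).imK + (h 1 0).imK) ^ 2 = 0 := by
      linear_combination hn
    refine ⟨?_, ?_, ?_, ?_⟩ <;> rw [← add_eq_zero_iff_eq_neg, ← sq_eq_zero_iff] <;>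
      apply le_antisymm _ (sq_nonneg _)
    · linarith [sq_nonneg ((h 0 1).imI + (h 1 0).imI), sq_nonneg ((h 0 1).imJ + (h 1 0).imJ),
        sq_nonneg ((h 0 1).imK + (h 1 0).imK)]
    · linarith [sq_nonneg ((h 1 1).re + (h 0 0).re), sq_nonneg ((h 0 1).imJ + (h 1 0).imJ),
        sq_nonneg ((h 0 1).imK + (h 1 0).imK)]
    · linarith [sq_nonneg ((h 1 1).re + (h 0 0).re), sq_nonneg ((h 0 1).imI + (h 1 0).imI),
        sq_nonneg ((h 0 1).imK + (h 1 0).imK)]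
    · linarith [sq_nonneg ((h 1 1).re + (h 0 0).re), sq_nonneg ((h 0 1).imI + (h 1 0).imI),
        sq_nonneg ((h 0 1).imJ + (h 1 0).imJ)]
  have hstar : h 0 0 + h 1 0 = -star (h 0 0 - h 0 1) := by
    obtain ⟨h1, h2, h3, h4⟩ := hre
    apply Quaternion.ext
    · rw [hk]; simp [h1]; ring
    · simp [h2]; ring
    · simp [h3]; ring
    · simp [h4]; ring
  -- If this entry difference vanishes, the upper right entry of the root equation is just `r = 0`.
  -- Otherwise it serves as the common direction in `exists_smul_of_commute`.
  by_cases hc : h 0 0 - h 0 1 = 0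
  · have ha : h 0 1 = h 0 0 := (sub_eq_zero.1 hc).symm
    have hk' : h 1 0 = -h 0 0 := by
      rw [hc, star_zero, neg_zero] at hstar
      exact eq_neg_of_add_eq_zero_right hstar
    have hd : h 1 1 = -h 0 0 := by
      rw [ha, hk'] at hk
      rw [hk]; abel
    have := congrFun (congrFun hroot 0) 1
    simp [-Matrix.cons_mul, Matrix.mul_apply, Fin.sum_univ_two, ha, hd, mat_algebraMap] at this
    exact ⟨0, by rw [this, zero_smul]⟩
  · refine exists_smul_of_commute hc hp hp0 hr0 ?_ ?_
    · rw [← mul_neg, ← hstar, mul_add, b00, sub_mul]; abel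
    · rw [← mul_neg, ← hstar, mul_add, c00, sub_mul]; abel

/-- `B² = 0` forces `‖p‖ = ‖m‖ = ‖q‖`, so `m = p * z` with a unit `z`, and conjugation by `diag(1,
z)`, which respects the adjoint, brings `B` to the shape of `exists_smul_of_null_std`. Then `B * C =
0` gives `C` the same shape. -/
theorem exists_smul_of_null {p m q : ℍ[ℝ]} {C h : Mat} {q₀ : ℝ} (hp : star p = -p)
    (hq : star q = -q) (hB0 : !![p, m; star m, q] ≠ 0)
    (hB2 : !![p, m; star m, q] * !![p, m; star m, q] = 0) (hC : rv C = -C)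
    (hBC : !![p, m; star m, q] * C = 0)
    (hBh : !![p, m; star m, q] * h = h * !![p, m; star m, q]) (hCh : C * h = h * C)
    (hroot : h * h + !![p, m; star m, q] * h + (algebraMap ℝ Mat q₀ + C) = 0)
    (hirr : ¬ IsUnit (h + rv h - !![p, m; star m, q])) :
    ∃ ν : ℝ, C = ν • !![p, m; star m, q] := by
  have e00 := congrFun (congrFun hB2 0) 0
  have e01 := congrFun (congrFun hB2 0) 1
  have e11 := congrFun (congrFun hB2 1) 1
  simp [Matrix.mul_apply, Fin.sum_univ_two] at e00 e01 e11
  have hpp : p * p = ((-normSq p : ℝ) : ℍ[ℝ]) := by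
    rw [Quaternion.coe_neg, ← self_mul_star, hp]; simp
  have hqq : q * q = ((-normSq q : ℝ) : ℍ[ℝ]) := by
    rw [Quaternion.coe_neg, ← self_mul_star, hq]; simp
  have hmp : normSq m = normSq p := by
    rw [hpp, self_mul_star, ← Quaternion.coe_add] at e00
    have := congrArg (fun w : ℍ[ℝ] => w.re) e00
    simp at this
    linarith
  have hmq : normSq m = normSq q := by
    rw [hqq, star_mul_self, ← Quaternion.coe_add] at e11
    have := congrArg (fun w : ℍ[ℝ] => w.re) e11
    simp at this
    linarith
  have hp0 : p ≠ 0 := by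
    rintro rfl
    apply hB0
    rw [map_zero] at hmp
    rw [hmp] at hmq
    rw [normSq_eq_zero] at hmp
    rw [eq_comm, normSq_eq_zero] at hmq
    subst hmp hmq
    apply Mat.ext <;> simp
  have hnp : normSq p ≠ 0 := normSq_ne_zero.2 hp0
  obtain ⟨z, hz⟩ : ∃ z, m = p * z := ⟨p⁻¹ * m, by rw [← mul_assoc, mul_inv_cancel₀ hp0, one_mul]⟩
  have hz1 : normSq z = 1 := by
    rw [hz, map_mul] at hmp
    exact mul_left_cancel₀ hnp (hmp.trans (mul_one _).symm)
  have hzz : z * star z = 1 := by rw [self_mul_star, hz1, Quaternion.coe_one]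
  have hzz' : star z * z = 1 := by rw [star_mul_self, hz1, Quaternion.coe_one]
  have hqz : q = -(star z * p * z) := by
    have h1 : p * (p * z + z * q) = 0 := by
      rw [← e01, hz]; simp only [mul_add, mul_assoc]
    have h2 := (mul_eq_zero.1 h1).resolve_left hp0
    have h3 := congrArg (star z * ·) h2
    simp only [mul_add, mul_zero] at h3
    rw [← mul_assoc _ z, hzz', one_mul, ← mul_assoc] at h3
    exact eq_neg_of_add_eq_zero_right h3
  let D : Mat := !![1, 0; 0, z]
  let D' : Mat := !![1, 0; 0, star z]
  have hDD' : D * D' = 1 := by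
    apply Mat.ext <;> simp [D, D', hzz]
  have hD'D : D' * D = 1 := by
    apply Mat.ext <;> simp [D, D', hzz']
  have hrD : rv D = D' := by apply Mat.ext <;> simp [D, D', rv]
  have hrD' : rv D' = D := by apply Mat.ext <;> simp [D, D', rv]
  have conj_mul : ∀ x y : Mat, D * x * D' * (D * y * D') = D * (x * y) * D' := by
    intro x y
    calc D * x * D' * (D * y * D') = D * x * (D' * D) * y * D' := by simp only [mul_assoc]
      _ = _ := by rw [hD'D, mul_one, mul_assoc D]
  have conj_inv : ∀ x : Mat, D' * (D * x * D') * D = x := by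
    intro x
    calc D' * (D * x * D') * D = (D' * D) * x * (D' * D) := by simp only [mul_assoc]
      _ = _ := by rw [hD'D, mul_one, one_mul]
  have conj_rv : ∀ x : Mat, rv (D * x * D') = D * rv x * D' := by
    intro x; rw [rv_mul, rv_mul, hrD, hrD', mul_assoc]
  have hBstd : D * !![p, m; star m, q] * D' = !![p, p; -p, -p] := by
    apply Mat.ext <;> simp [D, D', hz, hqz, mul_assoc, hzz, hp]
    · rw [← mul_assoc, hzz, one_mul]
    · rw [← mul_assoc z, hzz, one_mul]
  generalize !![p, m; star m, q] = B at *
  obtain ⟨r, k, l, hr, hl, hCstd⟩ := exists_eq_of_rv_eq_neg (x := D * C * D') (by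
    rw [conj_rv, hC, mul_neg, neg_mul])
  have hBC' : !![p, p; -p, -p] * !![r, k; star k, l] = 0 := by
    rw [← hBstd, ← hCstd, conj_mul, hBC, mul_zero, zero_mul]
  have f00 := congrFun (congrFun hBC' 0) 0
  have f01 := congrFun (congrFun hBC' 0) 1
  simp at f00 f01
  rw [← mul_add] at f00 f01
  have hk : star k = -r := eq_neg_of_add_eq_zero_right ((mul_eq_zero.1 f00).resolve_left hp0)
  have hk' : k = r := by
    rw [← star_star k, hk, star_neg, hr, neg_neg]
  have hl' : l = -k := eq_neg_of_add_eq_zero_right ((mul_eq_zero.1 f01).resolve_left hp0)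
  rw [hl', hk, hk'] at hCstd
  obtain ⟨ν, hν⟩ := exists_smul_of_null_std (p := p) (r := r) (h := D * h * D') (q := q₀) hp0 hp hr
    (by rw [← hBstd, conj_mul, conj_mul, hBh]) (by rw [← hCstd, conj_mul, conj_mul, hCh])
    (by
      have : algebraMap ℝ Mat q₀ = D * algebraMap ℝ Mat q₀ * D' := by
        rw [← Algebra.commutes, mul_assoc, hDD', mul_one]
      have e := congrArg (fun w => D * w * D') hroot
      rw [← hBstd, ← hCstd, conj_mul, conj_mul, this]
      simpa only [mul_add, add_mul, mul_zero, zero_mul] using e)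
    (by
      intro hU
      apply hirr
      rw [← hBstd, conj_rv, ← add_mul, ← mul_add, ← sub_mul, ← mul_sub] at hU
      rw [← conj_inv (h + rv h - B)]
      exact ((IsUnit.of_mul_eq_one D hD'D).mul hU).mul (IsUnit.of_mul_eq_one D' hDD'))
  refine ⟨ν, ?_⟩
  rw [← conj_inv C, hCstd, ← conj_inv B, hBstd, hν, ← smul_mul_assoc, ← mul_smul_comm]
  congr 2
  apply Mat.ext <;> simp

/-! ### Normal form and classification in the matrix model -/

/-- The image of `e₁₂ + e₃₊` in the matrix model. -/
def vil : Mat := !![0, 0; 0, -2 * qk]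

theorem vil_sq : vil * vil = algebraMap ℝ Mat (-2) + 2 * sym 1 0 := by
  rw [← map_ofNat (algebraMap ℝ Mat) 2, mat_algebraMap, mat_algebraMap]
  apply Mat.ext <;> simp [vil, sym]
  rw [show 2 * qk * (2 * qk) = 4 * (qk * qk) by noncomm_ring, qk_sq,
    show ((2 : ℝ) : ℍ[ℝ]) = 2 from rfl]
  norm_num

/-- A displacement that diagonalizes `B` carries `wedge` to a multiple of the pseudoscalar. -/
theorem mul_wedge_eq {a B W : Mat} {c β ω : ℝ} (hc : c ≠ 0) (ha : Intertwines a B (c • vil))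
    (hB : B * B = algebraMap ℝ Mat β + 2 * W) (hW : W * W = algebraMap ℝ Mat ω)  :
    a * W = c ^ 2 • (sym 1 0 * a) := by
  obtain ⟨h, r, hr, har, hra⟩ := ha
  have h1 : a * (2 * W) = (algebraMap ℝ Mat (-2 * c ^ 2 - β) + (2 * c ^ 2) • sym 1 0) * a := by
    have h2 : a * (B * B) = (c ^ 2) • (vil * vil) * a := by
      rw [← mul_assoc, h, mul_assoc, h, ← mul_assoc, smul_mul_smul_comm, sq]
    rw [hB, vil_sq, mul_add, ← Algebra.commutes, Algebra.algebraMap_eq_smul_one,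
      Algebra.algebraMap_eq_smul_one] at h2
    rw [eq_sub_of_add_eq' h2, Algebra.algebraMap_eq_smul_one, ← sub_mul]
    congr 1
    rw [two_mul]
    module
  -- The square of `2W` is scalar, so the mixed term of the squared right side of `h1` must vanish;
  -- this gives `β = -2c²`.
  have h3 : (algebraMap ℝ Mat (-2 * c ^ 2 - β) + (2 * c ^ 2) • sym 1 0) *
      (algebraMap ℝ Mat (-2 * c ^ 2 - β) + (2 * c ^ 2) • sym 1 0) * a =
      algebraMap ℝ Mat (4 * ω) * a := by
    rw [mul_assoc, ← h1, ← mul_assoc, ← h1, mul_assoc, Algebra.commutes]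
    congr 1
    rw [two_mul, add_mul, mul_add, hW, ← map_add, ← map_add]
    congr 1; ring
  have h4 := congrArg (· * rv a) h3
  simp only [mul_assoc _ a, har] at h4
  have h5 := congrArg (r⁻¹ • ·) h4
  simp only [← Algebra.commutes r, ← Algebra.smul_def, smul_smul, inv_mul_cancel₀ hr,
    one_smul] at h5
  rw [smul_sym] at h5
  have h6 : algebraMap ℝ Mat ((-2 * c ^ 2 - β) ^ 2 + (2 * c ^ 2) ^ 2 - 4 * ω) +
      sym (2 * (-2 * c ^ 2 - β) * (2 * c ^ 2)) 0 = 0 := by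
    rw [← sub_eq_zero] at h5
    rw [← h5, mat_algebraMap, mat_algebraMap, mat_algebraMap]
    apply Mat.ext <;> simp [sym] <;> norm_cast <;> congr 1 <;> ring
  have h7 := (sym_add_real_eq_zero h6).2.1
  have h8 : -2 * c ^ 2 - β = 0 := by
    have : c ^ 2 ≠ 0 := pow_ne_zero 2 hc
    have h9 : 4 * c ^ 2 ≠ 0 := mul_ne_zero four_ne_zero this
    apply (mul_eq_zero.1 _).resolve_right h9
    linear_combination h7
  rw [h8, map_zero, zero_add] at h1
  have h10 := congrArg ((2⁻¹ : ℝ) • ·) h1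
  simp only [two_mul (W), mul_add] at h10
  rw [← two_smul ℝ, smul_smul, smul_mul_assoc, smul_smul] at h10
  norm_num at h10
  convert h10 using 2
  ring

/-- The normal form of a motion polynomial `t² + t B + q` in the matrix model. -/
theorem exists_normal_form {h₁ h₂ : Mat} (hc : h₁ * h₂ = h₂ * h₁)
    (hB : rv (h₁ + h₂) = -(h₁ + h₂))
    (hN : ∀ t : ℝ, ∃ r : ℝ, (algebraMap ℝ Mat t - h₁) * (algebraMap ℝ Mat t - h₂) *
      rv ((algebraMap ℝ Mat t - h₁) * (algebraMap ℝ Mat t - h₂)) = algebraMap ℝ Mat r)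
    {β ω : ℝ} {W : Mat} (hB2 : (h₁ + h₂) * (h₁ + h₂) = algebraMap ℝ Mat β + 2 * W)
    (hW : W * W = algebraMap ℝ Mat ω) :
    ∃ (C : Mat) (q l γ : ℝ), rv C = -C ∧ h₁ * h₂ = algebraMap ℝ Mat q + C + W ∧
      rv (h₁ * h₂) = algebraMap ℝ Mat q - C + W ∧ (h₁ + h₂) * C = C * (h₁ + h₂) ∧
      (h₁ + h₂) * C = algebraMap ℝ Mat l ∧
      C * C = algebraMap ℝ Mat γ + 2 * algebraMap ℝ Mat q * W := by
  -- Three values of the quadrance suffice: the sum of those at `±1`, corrected by the one at 0,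
  -- isolates the quadratic coefficient, and their difference the odd part.
  obtain ⟨n₀, hn₀⟩ := hN 0
  obtain ⟨n₁, hn₁⟩ := hN 1
  obtain ⟨n₂, hn₂⟩ := hN (-1)
  have hq : ∀ S : Mat, S = h₁ + h₂ → S * (h₁ * h₂) = (h₁ * h₂) * S := by
    rintro _ rfl
    rw [add_mul, mul_add, ← mul_assoc h₂, ← hc, mul_assoc h₁ h₂ h₁, ← hc]
  have e₁ : (1 - h₁) * (1 - h₂) = 1 - (h₁ + h₂) + h₁ * h₂ := by noncomm_ring
  have e₂ : (-1 - h₁) * (-1 - h₂) = 1 + (h₁ + h₂) + h₁ * h₂ := by noncomm_ring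
  have hr1 : rv 1 = 1 := by simpa using rv_algebraMap 1
  rw [map_zero, zero_sub, zero_sub, neg_mul_neg] at hn₀
  rw [map_one, e₁, rv_add, rv_sub, hr1, hB, sub_neg_eq_add] at hn₁
  rw [map_neg, map_one, e₂, rv_add, rv_add, hr1, hB, ← sub_eq_add_neg] at hn₂
  have hS := hq _ rfl
  have hk : (h₁ + h₂) * rv (h₁ * h₂) = rv (h₁ * h₂) * (h₁ + h₂) := by
    have := congrArg rv hS
    rw [rv_mul (h₁ + h₂), rv_mul _ (h₁ + h₂), hB, mul_neg, neg_mul, neg_inj] at this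
    exact this.symm
  have hkk : rv (rv (h₁ * h₂)) = h₁ * h₂ := rv_rv _
  generalize hk₀ : rv (h₁ * h₂) = k at *
  generalize h₁ * h₂ = q at *
  generalize h₁ + h₂ = S at *
  have hsum : q + k = S * S + algebraMap ℝ Mat ((n₁ + n₂) / 2 - n₀ - 1) := by
    have : (2 : ℝ) • (q + k) = (2 : ℝ) • (S * S + algebraMap ℝ Mat ((n₁ + n₂) / 2 - n₀ - 1)) := by
      rw [smul_add (2 : ℝ) (S * S), Algebra.smul_def 2 (algebraMap ℝ Mat _), ← map_mul,
        show 2 * ((n₁ + n₂) / 2 - n₀ - 1) = n₁ + n₂ - n₀ - n₀ - 1 - 1 by ring]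
      simp only [map_sub, map_add, map_one, ← hn₀, ← hn₁, ← hn₂]
      rw [two_smul, two_smul]
      noncomm_ring
    exact smul_right_injective _ (two_ne_zero (α := ℝ)) this
  have hdiff : q * S - S * k = algebraMap ℝ Mat ((n₁ - n₂) / 2) := by
    have : (2 : ℝ) • (q * S - S * k) = (2 : ℝ) • algebraMap ℝ Mat ((n₁ - n₂) / 2) := by
      rw [Algebra.smul_def 2 (algebraMap ℝ Mat _), ← map_mul,
        show 2 * ((n₁ - n₂) / 2) = n₁ - n₂ by ring, map_sub, ← hn₁, ← hn₂, two_smul]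
      noncomm_ring
    exact smul_right_injective _ (two_ne_zero (α := ℝ)) this
  obtain ⟨n, hn⟩ : ∃ n : ℝ, n = ((n₁ + n₂) / 2 - n₀ - 1 + β) / 2 := ⟨_, rfl⟩
  have hqk : (2⁻¹ : ℝ) • (q + k) = algebraMap ℝ Mat n + W := by
    rw [hsum, hB2, hn, two_mul, Algebra.algebraMap_eq_smul_one, Algebra.algebraMap_eq_smul_one,
      Algebra.algebraMap_eq_smul_one]
    module
  obtain ⟨C, hC⟩ : ∃ C : Mat, C = (2⁻¹ : ℝ) • (q - k) := ⟨_, rfl⟩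
  have hSC : S * C = C * S := by
    rw [hC, mul_smul_comm, smul_mul_assoc, mul_sub, sub_mul, hS, hk]
  have hWC : W * C = C * W := by
    have h3 : S * S * C = C * (S * S) := by rw [mul_assoc, hSC, ← mul_assoc, hSC, mul_assoc]
    rw [hB2, add_mul, mul_add, Algebra.commutes, add_right_inj, two_mul, add_mul, mul_add,
      ← two_smul ℝ, ← two_smul ℝ (C * W)] at h3
    exact smul_right_injective _ (two_ne_zero (α := ℝ)) h3
  have e₃ : q = algebraMap ℝ Mat n + C + W := by
    rw [add_right_comm, ← hqk, hC]; module
  have e₄ : k = algebraMap ℝ Mat n - C + W := by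
    rw [sub_add_eq_add_sub, ← hqk, hC]; module
  refine ⟨C, n, (n₁ - n₂) / 4, n ^ 2 + ω - n₀, ?_, e₃, e₄, hSC, ?_, ?_⟩
  · rw [hC, rv_smul, rv_sub, hkk, hk₀, ← smul_neg, neg_sub]
  · rw [hC, mul_smul_comm, mul_sub, hS, hdiff, Algebra.smul_def, ← map_mul]
    congr 1; ring
  · have h5 : algebraMap ℝ Mat n * C = C * algebraMap ℝ Mat n := Algebra.commutes _ _
    have h6 : algebraMap ℝ Mat n * W = W * algebraMap ℝ Mat n := Algebra.commutes _ _
    have h7 : C * C = (algebraMap ℝ Mat n + W) * (algebraMap ℝ Mat n + W) - q * k := by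
      rw [e₃, e₄]
      simp only [add_mul, mul_add, mul_sub, h5, hWC]
      abel
    rw [h7, hn₀]
    simp only [add_mul, mul_add, ← h6, hW, map_add, map_sub, pow_two, map_mul, two_mul]
    abel

/-- Classification in the matrix model, for motions `t² - t (h₁ + h₂) + h₁ h₂` whose linear
coefficient is skew-adjoint. -/
theorem classification {h₁ h₂ : Mat} (hc : h₁ * h₂ = h₂ * h₁)
    (hB : rv (h₁ + h₂) = -(h₁ + h₂))
    (hN : ∀ t : ℝ, ∃ r : ℝ, (algebraMap ℝ Mat t - h₁) * (algebraMap ℝ Mat t - h₂) *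
      rv ((algebraMap ℝ Mat t - h₁) * (algebraMap ℝ Mat t - h₂)) = algebraMap ℝ Mat r)
    (hirr : ¬ IsUnit (h₁ - rv h₂)) :
    (∃ (H : Mat) (η q μ ν : ℝ), rv H = -H ∧ H * H = algebraMap ℝ Mat η ∧ (μ ≠ 0 ∨ ν ≠ 0) ∧
      h₁ + h₂ = -(μ • H) ∧ h₁ * h₂ = algebraMap ℝ Mat q + ν • H) ∨
    ∃ (a : Mat) (c : ℝ), c ≠ 0 ∧ Intertwines a (h₁ + h₂) (c • vil) ∧
      a * (h₁ * h₂) = c ^ 2 • (sym 1 0 * a) := by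
  obtain ⟨B, hBdef⟩ : ∃ B, B = -(h₁ + h₂) := ⟨_, rfl⟩
  have hBdef' : h₁ + h₂ = -B := by rw [hBdef, neg_neg]
  have hBr : rv B = -B := by rw [hBdef, rv_neg, hB]
  obtain ⟨p, m, q, hp, hq, hBm⟩ := exists_eq_of_rv_eq_neg hBr
  have hsq := skew_sq (m := m) hp hq
  rw [← hBm] at hsq
  obtain ⟨β, hβ⟩ : ∃ β, β = normSq m - (normSq p + normSq q) / 2 := ⟨_, rfl⟩
  obtain ⟨ω, hω⟩ : ∃ ω, ω = ((normSq q - normSq p) / 4) ^ 2 -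
    normSq ((2⁻¹ : ℝ) • (p * m + m * q)) := ⟨_, rfl⟩
  have hWsq : wedge p m q * wedge p m q = algebraMap ℝ Mat ω := by
    rw [hω]; exact sym_sq _ _
  rw [← hβ] at hsq
  obtain ⟨C, q₀, l, γ, hCr, hqe, hqr, hBC, hl, hγ⟩ := exists_normal_form hc hB hN
    (by rw [hBdef', neg_mul_neg, hsq]) hWsq
  rw [hBdef'] at hBC hl
  rw [neg_mul, mul_neg, neg_inj] at hBC
  have hl' : B * C = algebraMap ℝ Mat (-l) := by rw [map_neg, ← hl, neg_mul, neg_neg]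
  clear hl
  have hroot : h₁ * h₁ + B * h₁ + (algebraMap ℝ Mat q₀ + C + wedge p m q) = 0 := by
    rw [← hqe, hBdef, neg_mul, add_mul, hc]; abel
  have hroot' : rv h₁ * rv h₁ - rv h₁ * B + (algebraMap ℝ Mat q₀ - C + wedge p m q) = 0 := by
    have := congrArg rv hroot
    rw [← hqe, rv_add, rv_add, rv_mul, rv_mul, hBr, hqr] at this
    rw [← sub_eq_zero] at this
    rw [← this]
    have h0 : rv 0 = 0 := by simpa using rv_algebraMap 0
    rw [h0, mul_neg]; abel
  have hBh : B * h₁ = h₁ * B := by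
    rw [hBdef, neg_mul, mul_neg, add_mul, mul_add, hc]
  have hBh' : B * rv h₁ = rv h₁ * B := by
    have := congrArg rv hBh
    rw [rv_mul, rv_mul, hBr, mul_neg, neg_mul, neg_inj] at this
    exact this.symm
  have hirr' : ¬ IsUnit (h₁ + rv h₁ - B) := by
    have : rv h₂ = B - rv h₁ := by
      rw [eq_sub_iff_add_eq, add_comm, ← rv_add, hB, hBdef]
    rw [this] at hirr
    intro h; apply hirr; convert h using 1; abel
  by_cases hw : wedge p m q = 0
  · left
    rw [hw, mul_zero, add_zero] at hsq
    rw [hw, add_zero] at hqe hroot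
    rw [hw, mul_zero, add_zero] at hγ
    by_cases hB0 : B = 0
    · exact ⟨C, γ, q₀, 0, 1, hCr, hγ, Or.inr one_ne_zero, by rw [hBdef', hB0]; simp,
        by rw [hqe, one_smul]⟩
    · obtain ⟨ν, hν⟩ : ∃ ν : ℝ, C = ν • B := by
        -- For `β ≠ 0`, `B² = β` recovers `C` from the scalar `B * C`. For `β = 0` irregularity is
        -- needed.
        by_cases hβ0 : β = 0
        · have hB2 : B * B = 0 := by rw [hsq, hβ0, map_zero]
          have hl0 : B * C = 0 := by
            have h3 : B * (B * C) = 0 := by rw [← mul_assoc, hB2, zero_mul]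
            rw [hl', ← Algebra.commutes, ← Algebra.smul_def] at h3
            rw [hl', (smul_eq_zero.1 h3).resolve_right hB0, map_zero]
          have hCh : C * h₁ = h₁ * C := by
            have e : C = h₁ * h₂ - algebraMap ℝ Mat q₀ := by rw [hqe]; abel
            rw [e, sub_mul, mul_sub, Algebra.commutes, mul_assoc, ← hc]
          subst hBm
          exact exists_smul_of_null hp hq hB0 hB2 hCr hl0 hBh hCh hroot hirr'
        · refine ⟨-l / β, ?_⟩
          have h3 : B * (B * C) = β • C := by rw [← mul_assoc, hsq, Algebra.smul_def]
          rw [hl', ← Algebra.commutes, ← Algebra.smul_def] at h3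
          rw [div_eq_inv_mul, mul_smul, h3, smul_smul, inv_mul_cancel₀ hβ0, one_smul]
      exact ⟨B, β, q₀, 1, ν, hBr, hsq, Or.inl one_ne_zero, by rw [hBdef', one_smul],
        by rw [hqe, hν]⟩
  · right
    have h2W : ∀ X : Mat, B * X = X * B → wedge p m q * X = X * wedge p m q := by
      intro X hX
      have h3 : B * B * X = X * (B * B) := by rw [mul_assoc, hX, ← mul_assoc, hX, mul_assoc]
      rw [hsq, add_mul, mul_add, Algebra.commutes, add_right_inj, two_mul, add_mul, mul_add,
        ← two_smul ℝ, ← two_smul ℝ (X * _)] at h3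
      exact smul_right_injective _ (two_ne_zero (α := ℝ)) h3
    have hWh := h2W h₁ hBh
    have hWh' := h2W _ hBh'
    have hBW := (h2W B rfl).symm
    -- The grade-four part of `h₁ + rv h₁` commutes with `W`, hence is a multiple of it.
    obtain ⟨s, μ, hsμ⟩ : ∃ s μ : ℝ,
        h₁ + rv h₁ = 2 * (algebraMap ℝ Mat s + algebraMap ℝ Mat μ * wedge p m q) := by
      obtain ⟨s, f, y, hs⟩ := exists_eq_of_rv_eq (x := h₁ + rv h₁) (by
        rw [rv_add, rv_rv, add_comm])
      have hcomm : sym f y * wedge p m q = wedge p m q * sym f y := by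
        have e : sym f y = h₁ + rv h₁ - algebraMap ℝ Mat s := by rw [hs]; abel
        rw [e, sub_mul, mul_sub, add_mul, mul_add, hWh, hWh', Algebra.commutes]
      obtain ⟨μ, hμ⟩ := sym_commute hw hcomm
      refine ⟨s / 2, μ / 2, ?_⟩
      rw [hs, hμ, ← Algebra.smul_def, Algebra.algebraMap_eq_smul_one,
        Algebra.algebraMap_eq_smul_one, two_mul]
      change _ + μ • wedge p m q = _
      module
    have hindep : ∀ x y : ℝ, algebraMap ℝ Mat x + algebraMap ℝ Mat y * wedge p m q = 0 →
        x = 0 ∧ y = 0 := by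
      intro x y hxy
      rw [← Algebra.smul_def, wedge, smul_sym] at hxy
      obtain ⟨hx, h3, h4⟩ := sym_add_real_eq_zero hxy
      refine ⟨hx, ?_⟩
      by_contra hy
      apply hw
      rw [wedge, (mul_eq_zero.1 h3).resolve_left hy, (smul_eq_zero.1 h4).resolve_left hy]
      apply Mat.ext <;> simp [sym]
    have h4 := four_mul_le_sq p m q
    rw [← hβ, ← hω] at h4
    have h5 := trace_neg p m q hw
    rw [← hβ, ← hω] at h5
    rw [← hBh'] at hroot'
    obtain ⟨hC0, hq0, hβω⟩ := eq_zero_of_commute rfl hindep hWsq hsq hl' hγ hBW hBh hWh hsμ hroot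
      hroot' hirr' h4 h5
    subst hC0 hq0
    rw [map_zero, zero_add, zero_add] at hqe
    have hω0 : 0 ≤ ω := by nlinarith [sq_nonneg β]
    have hext := extremal p m q (by rw [← hβ, ← hω, hβω])
    have hne : ‖p‖ ≠ ‖q‖ := by
      intro h
      apply hw
      apply wedge_eq_zero p m q
      · rw [← hω]; exact hω0
      · rw [normSq_eq_norm_sq, normSq_eq_norm_sq, h]
    obtain ⟨a, x, hx, hx', ha⟩ := exists_intertwines_diag hp hq hext.1 hext.2 hne
    obtain ⟨b, c, hc0, hb⟩ := exists_intertwines_qk hx hx'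
    have hab := ha.trans hb
    rw [← hBm] at hab
    refine ⟨b * a, -c, neg_ne_zero.2 hc0, ⟨?_, hab.2⟩, ?_⟩
    · rw [hBdef', mul_neg, hab.1, neg_smul c vil, neg_mul (c • vil)]; rfl
    · rw [hqe, neg_sq]
      exact mul_wedge_eq hc0 hab hsq hWsq

/-! ### The even subalgebra is isomorphic to the matrix model -/

/-- The quaternion of the first four coordinates of a vector. -/
def quat (v : Fin 5 → ℝ) : ℍ[ℝ] := ⟨v 3, v 0, v 1, v 2⟩

theorem quat_add (v w : Fin 5 → ℝ) : quat (v + w) = quat v + quat w := rfl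

theorem quat_smul (r : ℝ) (v : Fin 5 → ℝ) : quat (r • v) = r • quat v := rfl

theorem normSq_quat (v : Fin 5 → ℝ) :
    normSq (quat v) = v 0 ^ 2 + v 1 ^ 2 + v 2 ^ 2 + v 3 ^ 2 := by
  rw [normSq_def']; simp only [quat]; ring

/-- The first spinor representation of vectors. -/
def gam : (Fin 5 → ℝ) →ₗ[ℝ] Mat where
  toFun v := !![((-v 4 : ℝ) : ℍ[ℝ]), quat v; star (quat v), ((-v 4 : ℝ) : ℍ[ℝ])]
  map_add' v w := by
    apply Mat.ext <;> simp [quat_add, add_comm]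
  map_smul' r v := by
    apply Mat.ext <;> simp [quat_smul, ← coe_mul_eq_smul]
    exact (coe_commutes _ _).symm

theorem gam_apply (v : Fin 5 → ℝ) :
    gam v = !![((-v 4 : ℝ) : ℍ[ℝ]), quat v; star (quat v), ((-v 4 : ℝ) : ℍ[ℝ])] := rfl

/-- The second spinor representation of vectors. -/
def gam' : (Fin 5 → ℝ) →ₗ[ℝ] Mat where
  toFun v := rv (gam v)
  map_add' v w := by rw [map_add, rv_add]
  map_smul' r v := by rw [map_smul, rv_smul]; rfl

theorem form_apply (v : Fin 5 → ℝ) :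
    form v = v 0 ^ 2 + v 1 ^ 2 + v 2 ^ 2 + v 3 ^ 2 - v 4 ^ 2 := by
  simp [form, QuadraticMap.weightedSumSquares_apply, Fin.sum_univ_five]
  ring

theorem gam'_apply (v : Fin 5 → ℝ) :
    gam' v = !![((-v 4 : ℝ) : ℍ[ℝ]), -quat v; -star (quat v), ((-v 4 : ℝ) : ℍ[ℝ])] := by
  change rv (gam v) = _
  rw [gam_apply]
  apply Mat.ext <;> simp [rv]

theorem neg_form (v : Fin 5 → ℝ) : -form v = v 4 * v 4 - normSq (quat v) := by
  rw [form_apply, normSq_quat]; ring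

theorem gam_mul_gam' (v : Fin 5 → ℝ) : gam v * gam' v = algebraMap ℝ Mat (-form v) := by
  rw [neg_form, gam_apply, gam'_apply, mat_algebraMap]
  apply Mat.ext <;> simp [self_mul_star, star_mul_self, sub_eq_add_neg, coe_mul_eq_smul,
    mul_coe_eq_smul]
  abel

theorem gam'_mul_gam (v : Fin 5 → ℝ) : gam' v * gam v = algebraMap ℝ Mat (-form v) := by
  rw [neg_form, gam_apply, gam'_apply, mat_algebraMap]
  apply Mat.ext <;> simp [self_mul_star, star_mul_self, sub_eq_add_neg, coe_mul_eq_smul,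
    mul_coe_eq_smul]
  abel

/-- The bilinear map that defines the matrix model. -/
def evenHom : CliffordAlgebra.EvenHom form Mat where
  -- The sign compensates for `gam v * gam' v = -form v`.
  bilin := -((LinearMap.mul ℝ Mat).compl₁₂ gam gam')
  contract v := by
    simp [gam_mul_gam']
  contract_mid u v w := by
    simp only [LinearMap.neg_apply, LinearMap.compl₁₂_apply, LinearMap.mul_apply', neg_mul_neg]
    rw [mul_assoc, ← mul_assoc (gam' v), gam'_mul_gam, ← mul_assoc, ← Algebra.commutes, mul_assoc,
      ← Algebra.smul_def, neg_smul, smul_neg]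

/-- The homomorphism to the matrix model. -/
def toMat : Even →ₐ[ℝ] Mat := CliffordAlgebra.even.lift form evenHom

theorem toMat_ι_mul_ι (v w : Fin 5 → ℝ) :
    toMat ⟨CliffordAlgebra.ι form v * CliffordAlgebra.ι form w,
      CliffordAlgebra.ι_mul_ι_mem_evenOdd_zero form _ _⟩ = -(gam v * gam' w) :=
  CliffordAlgebra.even.lift_ι form evenHom v w

theorem rev_mul (a b : Even) : rev (a * b) = rev b * rev a :=
  Subtype.ext (CliffordAlgebra.reverse.map_mul _ _)

theorem rev_add (a b : Even) : rev (a + b) = rev a + rev b := Subtype.ext (map_add _ _ _)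

theorem rev_rev (a : Even) : rev (rev a) = a :=
  Subtype.ext (CliffordAlgebra.reverse_reverse (a : Alg))

theorem rev_algebraMap (r : ℝ) : rev (algebraMap ℝ Even r) = algebraMap ℝ Even r :=
  Subtype.ext (CliffordAlgebra.reverse.commutes r)

theorem toMat_rev (a : Even) : toMat (rev a) = rv (toMat a) := by
  obtain ⟨a, ha⟩ := a
  induction a, ha using CliffordAlgebra.even_induction with
  | algebraMap r =>
    exact (congrArg toMat (rev_algebraMap r)).trans
      ((toMat.commutes r).trans ((rv_algebraMap r).symm.trans (congrArg rv (toMat.commutes r).symm)))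
  | add x y hx hy ihx ihy =>
    have := rev_add ⟨x, hx⟩ ⟨y, hy⟩
    refine (congrArg toMat this).trans ?_
    rw [map_add, ihx, ihy, ← rv_add, ← map_add]; rfl
  | ι_mul_ι_mul v w x hx ih =>
    have h1 := rev_mul ⟨CliffordAlgebra.ι form v * CliffordAlgebra.ι form w,
      CliffordAlgebra.ι_mul_ι_mem_evenOdd_zero form v w⟩ ⟨x, hx⟩
    have h2 : rev ⟨CliffordAlgebra.ι form v * CliffordAlgebra.ι form w,
      CliffordAlgebra.ι_mul_ι_mem_evenOdd_zero form v w⟩ =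
      ⟨CliffordAlgebra.ι form w * CliffordAlgebra.ι form v,
      CliffordAlgebra.ι_mul_ι_mem_evenOdd_zero form w v⟩ := Subtype.ext (by
        change CliffordAlgebra.reverse _ = _
        simp)
    have h3 : rv (gam v * gam' w) = gam w * gam' v := by
      rw [rv_mul]
      change rv (rv (gam w)) * _ = _
      rw [rv_rv]; rfl
    refine (congrArg toMat h1).trans ?_
    rw [map_mul, ih, h2, toMat_ι_mul_ι, ← h3, ← rv_neg, ← rv_mul, ← toMat_ι_mul_ι, ← map_mul]
    rfl

theorem finrank_alg : Module.finrank ℝ Alg = 32 := by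
  have : Invertible (2 : ℝ) := invertibleOfNonzero two_ne_zero
  rw [(CliffordAlgebra.equivExterior form).finrank_eq,
    Module.finrank_eq_card_basis (Pi.basisFun ℝ (Fin 5)).ExteriorAlgebra]
  rfl

instance : FiniteDimensional ℝ Alg := by
  have : Invertible (2 : ℝ) := invertibleOfNonzero two_ne_zero
  have := Module.Finite.of_basis (Pi.basisFun ℝ (Fin 5)).ExteriorAlgebra
  exact Module.Finite.equiv (CliffordAlgebra.equivExterior form).symm

/-- Right multiplication by `e₋` embeds the even part into the odd part, so the even part has at
most half of the dimension 32. -/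
theorem finrank_even : Module.finrank ℝ Even ≤ 16 := by
  have he : e 4 * e 4 = -1 := by
    rw [e, CliffordAlgebra.ι_sq_scalar, form_apply]; simp
  have hinj : Function.Injective (LinearMap.mulRight ℝ (e 4)) := by
    intro x y hxy
    have := congrArg (· * e 4) hxy
    simpa [mul_assoc, he] using this
  have h1 : Module.finrank ℝ (CliffordAlgebra.evenOdd form 0) ≤
      Module.finrank ℝ (CliffordAlgebra.evenOdd form 1) := by
    refine LinearMap.finrank_le_finrank_of_injective
      (f := (LinearMap.mulRight ℝ (e 4)).restrict (fun x hx => ?_)) ?_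
    · have := SetLike.mul_mem_graded hx (CliffordAlgebra.ι_mem_evenOdd_one form (Pi.single 4 1))
      simpa [e] using this
    · intro x y hxy
      exact Subtype.ext (hinj (congrArg Subtype.val hxy))
  have h2 := Submodule.finrank_add_eq_of_isCompl (CliffordAlgebra.evenOdd_isCompl form)
  rw [finrank_alg] at h2
  change Module.finrank ℝ (CliffordAlgebra.evenOdd form 0) ≤ 16
  lia

theorem toMat_bi (i j : Fin 5) :
    toMat (bi i j) = -(gam (Pi.single i 1) * gam' (Pi.single j 1)) :=
  toMat_ι_mul_ι _ _

/-- The quaternion unit `i`. -/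
def qi : ℍ[ℝ] := ⟨0, 1, 0, 0⟩

/-- The quaternion unit `j`. -/
def qj : ℍ[ℝ] := ⟨0, 0, 1, 0⟩

theorem quat_2 : quat (Pi.single 2 1) = qk := by
  apply Quaternion.ext <;> simp [quat, qk]

theorem quat_3 : quat (Pi.single 3 1) = 1 := by
  apply Quaternion.ext <;> simp <;> simp [quat]

theorem quat_4 : quat (Pi.single 4 1) = 0 := by
  apply Quaternion.ext <;> simp <;> simp [quat]

theorem toMat_bi_12 : toMat (bi 1 2) = -!![qi, 0; 0, qi] := by
  rw [toMat_bi, gam_apply, gam'_apply]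
  apply Mat.ext <;> simp <;> apply Quaternion.ext <;> simp <;> simp [quat, qi]

theorem toMat_bi_20 : toMat (bi 2 0) = -!![qj, 0; 0, qj] := by
  rw [toMat_bi, gam_apply, gam'_apply]
  apply Mat.ext <;> simp <;> apply Quaternion.ext <;> simp <;> simp [quat, qj]

theorem toMat_bi_01 : toMat (bi 0 1) = -!![qk, 0; 0, qk] := by
  rw [toMat_bi, gam_apply, gam'_apply]
  apply Mat.ext <;> simp <;> apply Quaternion.ext <;> simp <;> simp [quat, qk]

theorem toMat_bi_23 : toMat (bi 2 3) = !![qk, 0; 0, -qk] := by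
  rw [toMat_bi, gam_apply, gam'_apply, quat_3, quat_2]
  apply Mat.ext <;> simp
  rfl

theorem toMat_bi_34 : toMat (bi 3 4) = !![0, 1; 1, 0] := by
  rw [toMat_bi, gam_apply, gam'_apply, quat_3, quat_4]
  apply Mat.ext <;> simp

/-- The range contains the scalar quaternion matrices, the swap and `diag(1, -1)`; the last gives
the projections onto the rows, and these elements generate all matrices. -/
theorem toMat_surjective : Function.Surjective toMat := by
  intro x
  have hJ : sym 1 0 ∈ toMat.range := ⟨bi 0 1 * bi 2 3, by
    change toMat _ = _
    rw [map_mul, toMat_bi_01, toMat_bi_23]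
    apply Mat.ext <;> simp [sym, qk_sq]⟩
  have hS : !![0, 1; 1, 0] ∈ toMat.range := ⟨bi 3 4, toMat_bi_34⟩
  have hD : ∀ p : ℍ[ℝ], !![p, 0; 0, p] ∈ toMat.range := by
    intro p
    have : !![p, 0; 0, p] = toMat (algebraMap ℝ Even p.re - p.imI • bi 1 2 - p.imJ • bi 2 0 -
        p.imK • bi 0 1) := by
      rw [map_sub, map_sub, map_sub, map_smul, map_smul, map_smul, toMat_bi_12, toMat_bi_20,
        toMat_bi_01, AlgHom.commutes, mat_algebraMap]
      apply Mat.ext <;> simp <;> apply Quaternion.ext <;> simp <;> simp [qi, qj, qk]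
    rw [this]
    exact AlgHom.mem_range_self _ _
  have hx : x = (2⁻¹ : ℝ) • ((1 + sym 1 0) * (!![x 0 0, 0; 0, x 0 0] +
      !![x 0 1, 0; 0, x 0 1] * !![0, 1; 1, 0])) + (2⁻¹ : ℝ) • ((1 - sym 1 0) *
      (!![x 1 1, 0; 0, x 1 1] + !![x 1 0, 0; 0, x 1 0] * !![0, 1; 1, 0])) := by
    have h2 : ∀ y : ℍ[ℝ], (2⁻¹ : ℝ) • (y + y) = y := by
      intro y; rw [← two_smul ℝ, smul_smul, inv_mul_cancel₀ two_ne_zero, one_smul]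
    apply Mat.ext <;> simp [sym, Matrix.one_fin_two] <;> rw [add_mul, one_mul, h2]
  have : x ∈ toMat.range := by
    rw [hx]
    refine add_mem (Subalgebra.smul_mem _ ?_ _) (Subalgebra.smul_mem _ ?_ _)
    · exact mul_mem (add_mem (one_mem _) hJ) (add_mem (hD _) (mul_mem (hD _) hS))
    · exact mul_mem (sub_mem (one_mem _) hJ) (add_mem (hD _) (mul_mem (hD _) hS))
  exact this

theorem finrank_mat : Module.finrank ℝ Mat = 16 := by
  rw [Module.finrank_matrix, Quaternion.finrank_eq_four]
  simp

theorem toMat_injective : Function.Injective toMat := by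
  have h1 : Module.finrank ℝ Even = Module.finrank ℝ Mat :=
    le_antisymm (finrank_even.trans finrank_mat.ge)
      (LinearMap.finrank_le_finrank_of_surjective (f := toMat.toLinearMap) toMat_surjective)
  exact (LinearMap.injective_iff_surjective_of_finrank_eq_finrank (f := toMat.toLinearMap) h1).2
    toMat_surjective

/-! ### Quadratic polynomials, division and irregularity -/

section Quad

variable {R : Type*} [Ring R]

/-- The polynomial `x t² + y t + z`. -/
def quad (x y z : R) : R[X] := C x * X ^ 2 + C y * X + C z

theorem X_sub_C_mul_X_sub_C (a b : R) :
    (X - C a) * (X - C b) = quad 1 (-(a + b)) (a * b) := by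
  rw [quad, sub_mul, mul_sub, mul_sub, X_mul_C, C_neg, C_add, C_mul, C_1]
  noncomm_ring

theorem C_mul_quad_mul_C (a x y z b : R) :
    C a * quad x y z * C b = quad (a * x * b) (a * y * b) (a * z * b) := by
  simp only [quad, mul_add, add_mul, C_mul, mul_assoc, X_mul_C, X_pow_mul_C]

theorem smul_quad [Algebra ℝ R] (r : ℝ) (x y z : R) :
    r • quad x y z = quad (r • x) (r • y) (r • z) := by
  simp only [quad, smul_add, ← smul_mul_assoc, smul_C]

theorem quad_comp [Algebra ℝ R] (y z : R) (α β : ℝ) :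
    (quad 1 y z).comp (C (algebraMap ℝ R α) * X + C (algebraMap ℝ R β)) =
      quad (algebraMap ℝ R (α ^ 2)) (algebraMap ℝ R (2 * α * β) + α • y)
        (algebraMap ℝ R (β ^ 2) + β • y + z) := by
  simp only [quad, add_comp, C_mul_comp, X_comp, C_comp, X_pow_comp, C_1, one_mul]
  have h1 : ∀ (r : ℝ) (w : R), C (r • w) = C w * C (algebraMap ℝ R r) := by
    intro r w; rw [← C_mul, ← Algebra.commutes, ← Algebra.smul_def]
  have h0 : algebraMap ℝ R (2 * α * β) =
      algebraMap ℝ R α * algebraMap ℝ R β + algebraMap ℝ R α * algebraMap ℝ R β := by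
    rw [← map_mul, ← map_add]; congr 1; ring
  rw [C_add, C_add, C_add, h1, h1, h0, (algebraMap ℝ R).map_pow, (algebraMap ℝ R).map_pow, C_add,
    C_mul, C_pow, C_pow]
  have h2 : C (algebraMap ℝ R β) * C (algebraMap ℝ R α) =
      C (algebraMap ℝ R α) * C (algebraMap ℝ R β) := by
    rw [← C_mul, Algebra.commutes, C_mul]
  have h3 := X_mul_C (algebraMap ℝ R α)
  have h4 := X_mul_C (algebraMap ℝ R β)
  generalize C (algebraMap ℝ R α) = a at *
  generalize C (algebraMap ℝ R β) = b at *
  have h5 : a * X * (a * X) = a * a * (X * X) := by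
    rw [mul_assoc, ← mul_assoc X, h3]; simp only [mul_assoc]
  have h6 : a * X * b = a * b * X := by rw [mul_assoc, h4, mul_assoc]
  have h7 : b * (a * X) = a * b * X := by rw [← mul_assoc, h2]
  rw [pow_two, mul_add, add_mul, add_mul, h5, h6, h7]
  noncomm_ring

theorem coeff_one_quad (x y z : R) : (quad x y z).coeff 1 = y := by
  simp [quad]

theorem coeff_two_quad (x y z : R) : (quad x y z).coeff 2 = x := by
  simp [quad]

theorem natDegree_quad_le (x y z : R) : (quad x y z).natDegree ≤ 2 := by
  rw [quad]; compute_degree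

theorem quad_monic [Nontrivial R] (y z : R) : (quad 1 y z).Monic := by
  rw [quad]; monicity!

theorem quad_natDegree [Nontrivial R] (y z : R) : (quad 1 y z).natDegree = 2 := by
  refine le_antisymm (natDegree_quad_le _ _ _) (le_natDegree_of_ne_zero ?_)
  rw [coeff_two_quad]; exact one_ne_zero

/-- By degrees the quotient is the constant `F.coeff 2`, on whichever side it stands. -/
theorem coeff_one_of_eq {F Q M N : R[X]} (hM : M.Monic) (hM2 : M.natDegree = 2)
    (hR : N.degree < 2) (hF : F.natDegree ≤ 2) (h : F = Q * M + N ∨ F = M * Q + N) :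
    N.coeff 1 = F.coeff 1 - F.coeff 2 * M.coeff 1 ∨
      N.coeff 1 = F.coeff 1 - M.coeff 1 * F.coeff 2 := by
  have hR' : N.natDegree < 2 := by
    by_cases h0 : N = 0
    · rw [h0]; simp
    · exact (natDegree_lt_iff_degree_lt h0).2 hR
  have hM' : M.coeff 2 = 1 := by rw [← hM2]; exact hM.coeff_natDegree
  have hR2 : N.coeff 2 = 0 := coeff_eq_zero_of_natDegree_lt hR'
  have hFR : (F - N).natDegree ≤ 2 := natDegree_sub_le_of_le hF hR'.le
  rcases h with h | h
  · left
    have hQ : Q.natDegree = 0 := by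
      have e : F - N = Q * M := by rw [h]; abel
      by_cases h0 : Q = 0
      · rw [h0]; simp
      · rw [e, ← hM.natDegree_mul_comm, hM.natDegree_mul' h0, hM2] at hFR
        lia
    rw [eq_C_of_natDegree_eq_zero hQ] at h
    have h2 := congrArg (coeff · 2) h
    simp only [coeff_add, coeff_C_mul, hM', hR2, mul_one, add_zero] at h2
    rw [h2]
    have h1 := congrArg (coeff · 1) h
    simp only [coeff_add, coeff_C_mul] at h1
    rw [h1]; abel
  · right
    have hQ : Q.natDegree = 0 := by
      have e : F - N = M * Q := by rw [h]; abel
      by_cases h0 : Q = 0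
      · rw [h0]; simp
      · rw [e, hM.natDegree_mul' h0, hM2] at hFR
        lia
    rw [eq_C_of_natDegree_eq_zero hQ] at h
    have h2 := congrArg (coeff · 2) h
    simp only [coeff_add, coeff_mul_C, hM', hR2, one_mul, add_zero] at h2
    rw [h2]
    have h1 := congrArg (coeff · 1) h
    simp only [coeff_add, coeff_mul_C] at h1
    rw [h1]; abel

end Quad

theorem lin_mul_lin (a b : Even) : lin a * lin b = quad 1 (-(a + b)) (a * b) :=
  X_sub_C_mul_X_sub_C a b

theorem rev_sub (a b : Even) : rev (a - b) = rev a - rev b := Subtype.ext (map_sub _ _ _)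

theorem rev_one : rev 1 = 1 := by simpa using rev_algebraMap 1

theorem IsUnit.rev {a : Even} (h : IsUnit a) : IsUnit (rev a) := by
  obtain ⟨⟨a, b, hab, hba⟩, rfl⟩ := h
  exact ⟨⟨CGA.rev a, CGA.rev b, by rw [← rev_mul, hba, rev_one], by rw [← rev_mul, hab, rev_one]⟩,
    rfl⟩

/-- Irregularity of a factorization with two linear factors. -/
theorem IsIrregularFactorization.not_isUnit {P : Even[X]} {h₁ h₂ : Even}
    (h : IsIrregularFactorization P [h₁, h₂]) : P = lin h₁ * lin h₂ ∧ ¬ IsUnit (h₁ - CGA.rev h₂) := by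
  obtain ⟨hP, i, hi, Q, R, hR, hu, hQ⟩ := h
  refine ⟨by rw [hP]; simp [linProd], fun hU => hu ?_⟩
  have hlin : ∀ a : Even, (lin a).natDegree ≤ 2 ∧ (lin a).coeff 1 = 1 ∧ (lin a).coeff 2 = 0 := by
    intro a
    refine ⟨?_, ?_, ?_⟩
    · rw [lin]; exact (natDegree_X_sub_C_le _).trans one_le_two
    · simp [lin, coeff_X]
    · simp [lin, coeff_X]
  have hU' : IsUnit (CGA.rev h₁ - h₂) := by
    have := IsUnit.rev hU
    rwa [rev_sub, rev_rev] at this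
  simp only [List.length_cons, List.length_nil] at hi
  -- A single linear factor is its own remainder, with leading coefficient 1. Only the full product
  -- matters: it gives `rev h₁ - h₂` or `rev h₂ - h₁`, which are units together, by reversion and a
  -- sign.
  interval_cases i
  · simp only [linProd, List.take, List.drop, List.map, List.prod_cons, List.prod_nil, mul_one,
      List.getElem_cons_zero] at hQ
    rw [lin_mul_lin h₁ (CGA.rev h₁)] at hQ
    rcases hQ with hQ | hQ
    · have := coeff_one_of_eq (quad_monic _ _) (quad_natDegree _ _) hR (hlin h₁).1 (Or.inl hQ)
      rw [(hlin h₁).2.1, (hlin h₁).2.2, zero_mul, mul_zero, sub_zero, or_self] at this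
      rw [this]; exact isUnit_one
    · rw [lin_mul_lin] at hQ
      have := coeff_one_of_eq (quad_monic _ _) (quad_natDegree _ _) hR
        (natDegree_quad_le _ _ _) (Or.inr hQ)
      rw [coeff_one_quad, coeff_one_quad, coeff_two_quad, one_mul, mul_one, or_self] at this
      rw [this]
      convert hU' using 1; abel
  · simp only [linProd, List.take, List.drop, List.map, List.prod_cons, List.prod_nil, mul_one,
      List.getElem_cons_zero, List.getElem_cons_succ] at hQ
    rw [lin_mul_lin h₂ (CGA.rev h₂)] at hQ
    rcases hQ with hQ | hQ
    · rw [lin_mul_lin] at hQ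
      have := coeff_one_of_eq (quad_monic _ _) (quad_natDegree _ _) hR
        (natDegree_quad_le _ _ _) (Or.inl hQ)
      rw [coeff_one_quad, coeff_one_quad, coeff_two_quad, one_mul, mul_one, or_self] at this
      rw [this]
      convert hU.neg using 1; abel
    · have := coeff_one_of_eq (quad_monic _ _) (quad_natDegree _ _) hR (hlin h₂).1 (Or.inr hQ)
      rw [(hlin h₂).2.1, (hlin h₂).2.2, zero_mul, mul_zero, sub_zero, or_self] at this
      rw [this]; exact isUnit_one

/-! ### Real parameter values and transfer from the matrix model -/

/-- Evaluation at a real parameter as a ring homomorphism. -/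
def evalHom (t : ℝ) : Even[X] →+* Even :=
  eval₂RingHom' (RingHom.id Even) (algebraMap ℝ Even t) fun a => (Algebra.commutes t a).symm

theorem evalHom_apply (P : Even[X]) (t : ℝ) : evalHom t P = evalReal P t := rfl

theorem evalReal_lin (h : Even) (t : ℝ) : evalReal (lin h) t = algebraMap ℝ Even t - h := by
  simp [evalReal, lin]

theorem evalReal_mul (P Q : Even[X]) (t : ℝ) :
    evalReal (P * Q) t = evalReal P t * evalReal Q t := map_mul (evalHom t) P Q

theorem evalReal_map (N : ℝ[X]) (t : ℝ) :
    evalReal (N.map (algebraMap ℝ Even)) t = algebraMap ℝ Even (N.eval t) := by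
  rw [evalReal, eval_map, ← aeval_def, aeval_algebraMap_apply, aeval_def, eval₂_eq_eval_map,
    Algebra.algebraMap_self, map_id]

theorem evalReal_polyRev (P : Even[X]) (t : ℝ) : evalReal (polyRev P) t = CGA.rev (evalReal P t) := by
  let revHom : Even →+ Even := ⟨⟨CGA.rev, by simpa using rev_algebraMap 0⟩, rev_add⟩
  change _ = revHom (evalReal P t)
  rw [polyRev, ← evalHom_apply, evalReal, eval_eq_sum, Polynomial.sum, Polynomial.sum, map_sum,
    map_sum]
  refine Finset.sum_congr rfl fun n _ => ?_
  change evalReal _ t = CGA.rev _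
  rw [evalReal, eval_monomial, ← map_pow, rev_mul, rev_algebraMap, Algebra.commutes]

/-- A quartic with scalar values has scalar cubic coefficient. -/
theorem exists_add_eq_algebraMap {A : Type*} [Ring A] [Algebra ℝ A] {S T p q : A}
    (h : ∀ t : ℝ, ∃ r : ℝ, (algebraMap ℝ A t ^ 2 - t • S + p) * (algebraMap ℝ A t ^ 2 - t • T + q) =
      algebraMap ℝ A r) : ∃ n : ℝ, S + T = algebraMap ℝ A n := by
  obtain ⟨r₂, h₂⟩ := h 2
  obtain ⟨r₁, h₁⟩ := h 1
  obtain ⟨r₀, h₀⟩ := h 0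
  obtain ⟨r, h⟩ := h (-1)
  -- Third difference over the nodes 2, 1, 0, -1: it is 12 on `t⁴`, 6 on `t³` and annihilates lower
  -- degrees.
  have h6 : (6 : ℝ) • (S + T) = algebraMap ℝ A (12 - (r₂ - 3 * r₁ + 3 * r₀ - r)) := by
    simp only [map_sub, map_add, map_mul, map_ofNat, ← h₂, ← h₁, ← h₀, ← h, ofNat_smul_eq_nsmul,
      one_smul, zero_smul, neg_smul, map_one, map_zero, map_neg]
    noncomm_ring
    simp
  refine ⟨6⁻¹ * (12 - (r₂ - 3 * r₁ + 3 * r₀ - r)), ?_⟩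
  rw [map_mul, ← h6, ← Algebra.smul_def, smul_smul, inv_mul_cancel₀ (by norm_num), one_smul]

/-- Evaluation of a quadratic motion with shifted parameter. -/
theorem lin_mul_lin_eval {A : Type*} [Ring A] [Algebra ℝ A] (h₁ h₂ : A) (t : ℝ) :
    (algebraMap ℝ A t - h₁) * (algebraMap ℝ A t - h₂) =
      algebraMap ℝ A t ^ 2 - t • (h₁ + h₂) + h₁ * h₂ := by
  rw [Algebra.smul_def, sub_mul, mul_sub, mul_sub, ← Algebra.commutes t h₁]
  noncomm_ring

theorem rev_smul (r : ℝ) (a : Even) : rev (r • a) = r • rev a := Subtype.ext (map_smul _ _ _)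

/-- The matrix model as an isomorphism. -/
def matEquiv : Even ≃ₐ[ℝ] Mat :=
  AlgEquiv.ofBijective toMat ⟨toMat_injective, toMat_surjective⟩

theorem toMat_vil : toMat (bi 0 1 + bi 2 3) = vil := by
  rw [map_add, toMat_bi_01, toMat_bi_23]
  apply Mat.ext <;> simp [vil]
  noncomm_ring

theorem toMat_bi_mul_bi : toMat (bi 0 1 * bi 2 3) = sym 1 0 := by
  rw [map_mul, toMat_bi_01, toMat_bi_23]
  apply Mat.ext <;> simp [sym, qk_sq]

theorem isTrivialMotion_of_eq {h₁ h₂ H : Even} {p η q μ ν : ℝ} (hH : rev H = -H)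
    (hH2 : H * H = algebraMap ℝ Even η) (h0 : μ ≠ 0 ∨ ν ≠ 0)
    (hS : h₁ + algebraMap ℝ Even p + (h₂ + algebraMap ℝ Even p) = -(μ • H))
    (hp : (h₁ + algebraMap ℝ Even p) * (h₂ + algebraMap ℝ Even p) = algebraMap ℝ Even q + ν • H) :
    IsTrivialMotion (lin h₁ * lin h₂) := by
  have hval : ∀ t : ℝ, evalReal (lin h₁ * lin h₂) t =
      algebraMap ℝ Even ((t + p) ^ 2 + q) + (μ * (t + p) + ν) • H := by
    intro t
    have := lin_mul_lin_eval (h₁ + algebraMap ℝ Even p) (h₂ + algebraMap ℝ Even p) (t + p)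
    rw [hS, hp, map_add, add_sub_add_right_eq_sub, add_sub_add_right_eq_sub, ← map_add, ← map_pow]
      at this
    rw [evalReal_mul, evalReal_lin, evalReal_lin, this, map_add]
    module
  -- By `hval`, dividing out the coefficient of `H` leaves this `f`; the exceptional parameters are
  -- the zeros of that coefficient.
  refine ⟨fun t => ((t + p) ^ 2 + q) / (μ * (t + p) + ν), -H, fun t => ⟨t ^ 2 - η, ?_⟩, ?_⟩
  · rw [sub_neg_eq_add, rev_add, rev_algebraMap, hH, add_mul, mul_add, mul_add, mul_neg, mul_neg,
      hH2, Algebra.commutes t H, map_sub, map_pow, pow_two]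
    abel
  · refine Set.Finite.subset (s := {t : ℝ | μ * (t + p) + ν = 0}) ?_ fun t ht => ?_
    · refine Set.Subsingleton.finite fun x hx y hy => ?_
      change μ * (x + p) + ν = 0 at hx
      change μ * (y + p) + ν = 0 at hy
      have hμ : μ ≠ 0 := by
        rintro rfl
        simp_all
      exact mul_left_cancel₀ hμ (by linear_combination hx - hy)
    · by_contra h
      refine ht ⟨μ * (t + p) + ν, h, ?_⟩
      rw [hval, sub_neg_eq_add, smul_add, Algebra.smul_def _ (algebraMap ℝ Even _), ← map_mul,
        mul_div_cancel₀ _ h]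

theorem conformallyEquivalent_of_intertwines {h₁ h₂ a : Even} {p γ r : ℝ} (hγ : γ ≠ 0) (hr : r ≠ 0)
    (ha : a * rev a = algebraMap ℝ Even r) (ha' : rev a * a = algebraMap ℝ Even r)
    (hS : a * (h₁ + algebraMap ℝ Even p + (h₂ + algebraMap ℝ Even p)) =
      (γ • (bi 0 1 + bi 2 3)) * a)
    (hp : a * ((h₁ + algebraMap ℝ Even p) * (h₂ + algebraMap ℝ Even p)) =
      γ ^ 2 • (bi 0 1 * bi 2 3 * a)) :
    ConformallyEquivalent (lin h₁ * lin h₂) villarceau := by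
  -- The substitution `t ↦ γt - p` undoes the shift and scales the roots by `1/γ`; `γ²` is the new
  -- leading coefficient and `r` the quadrance of `a`.
  refine ⟨a, γ, -p, γ ^ 2 * r, ⟨r, hr, ha, ha'⟩, hγ, mul_ne_zero (pow_ne_zero 2 hγ) hr, ?_⟩
  have hy : algebraMap ℝ Even (2 * γ * -p) + γ • -(h₁ + h₂) =
      -(γ • (h₁ + algebraMap ℝ Even p + (h₂ + algebraMap ℝ Even p))) := by
    simp only [Algebra.algebraMap_eq_smul_one]; module
  have hz : algebraMap ℝ Even ((-p) ^ 2) + -p • -(h₁ + h₂) + h₁ * h₂ =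
      (h₁ + algebraMap ℝ Even p) * (h₂ + algebraMap ℝ Even p) := by
    rw [add_mul, mul_add, mul_add, ← map_mul, ← Algebra.commutes p h₁, ← Algebra.smul_def,
      ← Algebra.smul_def]
    simp only [Algebra.algebraMap_eq_smul_one]; module
  rw [villarceau, lin_mul_lin, lin_mul_lin, quad_comp, C_mul_quad_mul_C, smul_quad, hy, hz, hp,
    mul_neg, mul_smul_comm, hS, ← Algebra.commutes, mul_assoc, ha, ← map_mul, smul_mul_assoc,
    neg_mul, smul_mul_assoc, smul_mul_assoc, smul_mul_assoc, mul_assoc _ a, mul_assoc _ a, ha,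
    ← Algebra.commutes, ← Algebra.commutes, ← Algebra.smul_def, ← Algebra.smul_def,
    Algebra.algebraMap_eq_smul_one, smul_smul, smul_smul, smul_smul, smul_neg, ← pow_two]

end CGA

end

theorem mainTheorem3 (P : Polynomial CGA.Even) (hP : CGA.IsMotionPolynomial P)
    (hdeg : P.natDegree = 2) (h₁ h₂ : CGA.Even)
    (hirr : CGA.IsIrregularFactorization P [h₁, h₂])
    (hcomm : h₁ * h₂ = h₂ * h₁) :
    CGA.IsTrivialMotion P ∨ CGA.ConformallyEquivalent P CGA.villarceau := by
  obtain ⟨rfl, hu⟩ := hirr.not_isUnit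
  have hN : ∀ t : ℝ, ∃ r : ℝ, (algebraMap ℝ CGA.Even t - h₁) * (algebraMap ℝ CGA.Even t - h₂) *
      CGA.rev ((algebraMap ℝ CGA.Even t - h₁) * (algebraMap ℝ CGA.Even t - h₂)) =
      algebraMap ℝ CGA.Even r := by
    intro t
    obtain ⟨N, -, hN, -⟩ := hP
    have := congrArg (CGA.evalReal · t) hN
    simp only [CGA.evalReal_mul, CGA.evalReal_polyRev, CGA.evalReal_lin, CGA.evalReal_map] at this
    exact ⟨_, this⟩
  obtain ⟨n, hn⟩ : ∃ n : ℝ, h₁ + h₂ + CGA.rev (h₁ + h₂) = algebraMap ℝ CGA.Even n := by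
    refine CGA.exists_add_eq_algebraMap (p := h₁ * h₂) (q := CGA.rev (h₁ * h₂)) fun t => ?_
    obtain ⟨r, hr⟩ := hN t
    refine ⟨r, ?_⟩
    rw [← hr, CGA.lin_mul_lin_eval, CGA.rev_add (_ - _), CGA.rev_sub, CGA.rev_smul, ← map_pow,
      CGA.rev_algebraMap]
  -- Adding `p` to both roots adds `4p` to `h₁ + h₂ + rev (h₁ + h₂)`, so this choice cancels `n`.
  set p : ℝ := -n / 4 with hp
  set k₁ := h₁ + algebraMap ℝ CGA.Even p with hk₁
  set k₂ := h₂ + algebraMap ℝ CGA.Even p with hk₂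
  have hc : CGA.toMat k₁ * CGA.toMat k₂ = CGA.toMat k₂ * CGA.toMat k₁ := by
    have h : Commute h₁ h₂ := hcomm
    rw [← map_mul, ← map_mul]
    exact congrArg _ ((h.add_right (Algebra.commute_algebraMap_right p h₁)).add_left
      (Algebra.commute_algebraMap_left p k₂)).eq
  have hB : CGA.rv (CGA.toMat k₁ + CGA.toMat k₂) = -(CGA.toMat k₁ + CGA.toMat k₂) := by
    rw [← map_add, ← CGA.toMat_rev, ← map_neg]
    congr 1
    have e : k₁ + k₂ = h₁ + h₂ + algebraMap ℝ CGA.Even (2 * p) := by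
      rw [hk₁, hk₂, two_mul, map_add]; abel
    have e2 : CGA.rev (h₁ + h₂) = algebraMap ℝ CGA.Even n - (h₁ + h₂) := by rw [← hn]; abel
    have e3 : n = -(2 * p) - 2 * p := by rw [hp]; ring
    rw [e, CGA.rev_add, CGA.rev_algebraMap, e2, e3, map_sub, map_neg]
    abel
  have hN' : ∀ t : ℝ, ∃ r : ℝ,
      (algebraMap ℝ CGA.Mat t - CGA.toMat k₁) * (algebraMap ℝ CGA.Mat t - CGA.toMat k₂) *
      CGA.rv ((algebraMap ℝ CGA.Mat t - CGA.toMat k₁) * (algebraMap ℝ CGA.Mat t - CGA.toMat k₂)) =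
      algebraMap ℝ CGA.Mat r := by
    intro t
    obtain ⟨r, hr⟩ := hN (t - p)
    refine ⟨r, ?_⟩
    have e : ∀ h : CGA.Even, algebraMap ℝ CGA.Mat t - CGA.toMat (h + algebraMap ℝ CGA.Even p) =
        CGA.toMat (algebraMap ℝ CGA.Even (t - p) - h) := by
      intro h
      rw [← CGA.toMat.commutes t, ← map_sub, map_sub (algebraMap ℝ CGA.Even)]
      congr 1; abel
    rw [e, e, ← map_mul, ← CGA.toMat_rev, ← map_mul, hr, CGA.toMat.commutes]
  have hu' : ¬ IsUnit (CGA.toMat k₁ - CGA.rv (CGA.toMat k₂)) := by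
    rw [← CGA.toMat_rev, ← map_sub, hk₁, hk₂, CGA.rev_add, CGA.rev_algebraMap,
      add_sub_add_right_eq_sub]
    exact fun h => hu ((isUnit_map_iff CGA.matEquiv _).1 h)
  rcases CGA.classification hc hB hN' hu' with
    ⟨H, η, q, μ, ν, hH, hH2, h0, hS, hq⟩ | ⟨a, γ, hγ, ⟨hS, r, hr, ha, ha'⟩, hq⟩
  · left
    obtain ⟨H, rfl⟩ := CGA.toMat_surjective H
    refine CGA.isTrivialMotion_of_eq (H := H) (p := p) (η := η) (q := q) (CGA.toMat_injective ?_)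
      (CGA.toMat_injective ?_) h0 (CGA.toMat_injective ?_) (CGA.toMat_injective ?_)
    · rw [CGA.toMat_rev, hH, map_neg]
    · rw [map_mul, hH2, CGA.toMat.commutes]
    · rw [map_add, hS, map_neg, map_smul]
    · rw [map_mul, hq, map_add, CGA.toMat.commutes, map_smul]
  · right
    obtain ⟨a, rfl⟩ := CGA.toMat_surjective a
    refine CGA.conformallyEquivalent_of_intertwines (a := a) (p := p) hγ hr
      (CGA.toMat_injective ?_) (CGA.toMat_injective ?_) (CGA.toMat_injective ?_)
      (CGA.toMat_injective ?_)
    · rw [map_mul, CGA.toMat_rev, ha, CGA.toMat.commutes]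
    · rw [map_mul, CGA.toMat_rev, ha', CGA.toMat.commutes]
    · rw [map_mul, map_add, hS, map_mul, map_smul, CGA.toMat_vil]
    · rw [map_mul, map_mul, hq, map_smul, map_mul, CGA.toMat_bi_mul_bi]
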